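/- Let $M$ be a connected, Hausdorff, second countable smooth manifold without boundary, and let $G$ be a connected Lie group acting on $M$. Let $K$ be a compact Lie group that contains $G$ as a dense Lie subgroup (that is, there is an injective smooth homomorphism $G\to K$ with dense image, through which $G$ is regarded as a subgroup of $K$), and suppose that the action of $G$ on $M$ is the restriction of a smooth action of $K$ on $M$. For $x\in M$ let $G_x\subset G$ be its isotropy subgroup, a closed subgroup of the Lie group $G$, and let $(G_x)_0$ be the identity component of $G_x$. The strata of $M$ are the classes of the equivalence relation $x\sim y\iff \dim G_x=\dim G_y$, and the regular stratum $R_{\mathcal F}$ is the open stratum, i.e. the set of the points whose stratum is open in $M$. Fix a base point $p\in R_{\mathcal F}$ and put $L=(G_p)_0$. Then for every $x\in R_{\mathcal F}$ there is $k\in K$ with $(G_x)_0=kLk^{-1}$. Moreover, $k$ can be chosen locally as a smooth function of $x$: every $x\in R_{\mathcal F}$ has an open neighborhood $V\subset R_{\mathcal F}$ and a smooth map $f\colon V\to K$ such that $(G_y)_0=f(y)\,L\,f(y)^{-1}$ for every $y\in V$. -/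

import Mathlib

open Set Topology
open scoped Manifold ContDiff

namespace KillingFoliation

/-- The identity component `S₀` of a subgroup `S` of a topological group `G`,
viewed again as a subgroup of `G`. -/
def identityComponent {G : Type*} [TopologicalSpace G] [Group G] [IsTopologicalGroup G]
    (S : Subgroup G) : Subgroup G :=
  (Subgroup.connectedComponentOfOne S).map S.subtype

/-- The conjugate subgroup `k S k⁻¹`. -/
def conjugate {K : Type*} [Group K] (k : K) (S : Subgroup K) : Subgroup K :=
  S.map (MulAut.conj k).toMonoidHom

section Dimension

variable (E : Type*) [NormedAddCommGroup E] [NormedSpace ℝ E]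
  {G : Type*} [TopologicalSpace G] [ChartedSpace E G] [Group G]

/-- The tangent space at the identity of a subgroup `S` of the Lie group `G` (modelled on `E`):
the subspace of `T₁G` spanned by the velocities at time `0` of the smooth curves of `G` that
take their values in `S` and pass through `1` at time `0`. For a closed subgroup `S` the set of
these velocities is already a subspace, namely the Lie algebra of the Lie group `S`. -/
noncomputable def tangentAtOne (S : Subgroup G) : Submodule ℝ (GroupLieAlgebra 𝓘(ℝ, E) G) :=
  Submodule.span ℝ {v | ∃ γ : ℝ → G, ContMDiff 𝓘(ℝ, ℝ) 𝓘(ℝ, E) ∞ γ ∧ (∀ t, γ t ∈ S) ∧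
    γ 0 = 1 ∧ v = mfderiv 𝓘(ℝ, ℝ) 𝓘(ℝ, E) γ 0 (1 : ℝ)}

/-- The dimension of a closed subgroup `S` of the Lie group `G`. -/
noncomputable def subgroupDim (S : Subgroup G) : ℕ :=
  Module.finrank ℝ (tangentAtOne E S)

variable (G) {M : Type*} [MulAction G M]

/-- The stratum through `x`: the class of `x` for the relation
`x ∼ y ↔ dim G_x = dim G_y`. -/
def stratum (x : M) : Set M :=
  {y | subgroupDim E (MulAction.stabilizer G x) = subgroupDim E (MulAction.stabilizer G y)}

variable (M) in
/-- The regular stratum `R_𝓕`, that is, the open stratum: the points whose stratum is open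
in `M`. -/
def regularStratum [TopologicalSpace M] : Set M :=
  {x | IsOpen (stratum E G x)}

end Dimension

end KillingFoliation

/-! The group `K` permutes the isotropy groups of `G` by conjugation, and along a slice of the
`K`-action isotropy groups can only shrink, so that constancy of their dimension freezes their
identity components.

Conjugation. The Lie algebra of `G` is invariant under `Ad k` for every `k` in `K`: the condition is
closed in `k` and holds on the dense image of `G` (`adj_mem_range`). Integrating this shows that `k
* ι g * k⁻¹` lies in the image of `G` for `g` near `1`, hence for all `g` by connectedness. So each
`k` induces a smooth automorphism of `G` (`exists_conjEquiv`), which carries `G_x` onto the isotropy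
group of `k • x`. Thus the dimension of isotropy is `K`-invariant and identity components are
conjugated by `k`.

Local statement. By the slice theorem (`exists_slice`), each `y` near `x` is `c y • r y` with `c`
smooth and the isotropy group of `r y` inside that of `x`. Hence the dimension is upper
semicontinuous. Where it is locally constant, nested isotropy groups of equal dimension agree near
`1` (`eventually_mem_stabilizer`), and `c y` conjugates `(G_x)_0` to `(G_y)_0`.

Global statement. Points near which the dimension is constant are dense, and `M` is connected, so it
suffices that near an arbitrary point `x`, possibly singular, any two such points have conjugate
isotropy (`eventually_conjIsotropy`). Move both into the slice, where `K_x` acts by isometries, and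
turn the second one by `K_x` into a point `w` nearest to the first one `v`. By Kleiner's argument
(`eq_of_fixes_segment`) the isotropy group at every interior point of the segment is `G_v ∩ G_w`.
Regularity at the two ends gives this intersection the dimension of `G_v` and of `G_w`, so both have
its identity component. Connectedness of the regular stratum is never needed.

Two tools carry the analysis: the tubular map `exists_tube`, which confines maps tangent to orbits
to a single local orbit, and Bochner linearization by averaging over a compact isotropy group
(`exists_equivariant_chart`). -/

namespace KillingFoliation

open Filter MeasureTheory

universe u

/-! ### Inverse functions and integrals depending smoothly on parameters -/

section Calculus

variable {E F Q : Type*} [NormedAddCommGroup E] [NormedSpace ℝ E]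
  [NormedAddCommGroup F] [NormedSpace ℝ F] [NormedAddCommGroup Q] [NormedSpace ℝ Q]

/-- The inverse function theorem, with smoothness of the inverse on a neighbourhood. -/
theorem exists_smooth_local_inverse [CompleteSpace E] {f : E → F} {a : E} {f' : E ≃L[ℝ] F}
    (hf : ∀ᶠ x in 𝓝 a, ContDiffAt ℝ ∞ f x) (hf' : HasFDerivAt f (f' : E →L[ℝ] F) a) :
    ∃ g : F → E, g (f a) = a ∧ (∀ᶠ y in 𝓝 (f a), ContDiffAt ℝ ∞ g y) ∧
      (∀ᶠ x in 𝓝 a, g (f x) = x) ∧ ∀ᶠ y in 𝓝 (f a), f (g y) = y := by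
  have ha : ContDiffAt ℝ ∞ f a := hf.self_of_nhds
  have hne : (∞ : WithTop ℕ∞) ≠ 0 := by simp
  set e := ha.toOpenPartialHomeomorph f hf' hne with he
  have hecoe : ⇑e = f := ha.toOpenPartialHomeomorph_coe hf' hne
  have hsrc : a ∈ e.source := ha.mem_toOpenPartialHomeomorph_source hf' hne
  have htgt : f a ∈ e.target := by rw [← hecoe]; exact e.map_source hsrc
  have hinv : e.symm (f a) = a := by rw [← hecoe]; exact e.left_inv hsrc
  have hcont : Tendsto e.symm (𝓝 (f a)) (𝓝 a) := by
    have := e.continuousAt_symm htgt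
    rwa [ContinuousAt, hinv] at this
  -- Invertible maps form an open set and the derivative is continuous at `a`. Invertibility near
  -- `a` is what makes the inverse smooth near `f a` and not only at `f a`.
  have hequiv : ∀ᶠ x in 𝓝 a, fderiv ℝ f x ∈ range ((↑) : (E ≃L[ℝ] F) → E →L[ℝ] F) := by
    have hc : ContinuousAt (fderiv ℝ f) a :=
      (ha.fderiv_right (m := 0) (by simp)).continuousAt
    apply hc
    rw [hf'.fderiv]
    exact f'.nhds
  refine ⟨e.symm, hinv, ?_, ?_, ?_⟩
  · filter_upwards [hcont.eventually hf, hcont.eventually hequiv,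
      e.open_target.mem_nhds htgt] with y hy ⟨f₁, hf₁⟩ hyt
    refine e.contDiffAt_symm (f₀' := f₁) hyt ?_ (by rwa [hecoe])
    rw [hecoe, hf₁]
    exact (hy.differentiableAt hne).hasFDerivAt
  · filter_upwards [e.open_source.mem_nhds hsrc] with x hx
    rw [← hecoe]; exact e.left_inv hx
  · filter_upwards [e.open_target.mem_nhds htgt] with y hy
    rw [← hecoe]; exact e.right_inv hy

/-- The partial derivative of a smooth function is smooth. -/
theorem eventually_contDiffAt_partial_fderiv {g : Q × E → F} {z : Q × E}
    (hg : ∀ᶠ z' in 𝓝 z, ContDiffAt ℝ ∞ g z') :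
    ∀ᶠ z' in 𝓝 z, ContDiffAt ℝ ∞ (fun z : Q × E ↦ fderiv ℝ (fun e ↦ g (z.1, e)) z.2) z' := by
  filter_upwards [hg] with z' hz'
  refine ContDiffAt.fderiv (n := ∞) (f := fun (z : Q × E) (e : E) ↦ g (z.1, e)) ?_
    contDiffAt_snd (by simp)
  have : ContDiffAt ℝ ∞ g ((fun w : (Q × E) × E ↦ (w.1.1, w.2)) (z', z'.2)) := hz'
  exact this.comp (z', z'.2) (by fun_prop)

/-- A family of maps that is given locally by smooth maps depending on parameters in a normed
space. -/
def LocSmoothFamily (Q : Type*) [NormedAddCommGroup Q] [NormedSpace ℝ Q]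
    {X : Type*} [TopologicalSpace X] (U : Set E) (f : X → E → F) : Prop :=
  ∀ h₀, ∀ e₀ ∈ U, ∃ (q : X → Q) (g : Q × E → F), ContinuousAt q h₀ ∧
    (∀ᶠ z in 𝓝 (q h₀, e₀), ContDiffAt ℝ ∞ g z) ∧
    ∀ᶠ z : X × E in 𝓝 (h₀, e₀), f z.1 z.2 = g (q z.1, z.2)

variable {X : Type*} [TopologicalSpace X] {U : Set E} {f : X → E → F}

theorem LocSmoothFamily.continuousAt (hf : LocSmoothFamily Q U f) (h : X) {e : E} (he : e ∈ U) :
    ContinuousAt (fun z : X × E ↦ f z.1 z.2) (h, e) := by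
  obtain ⟨q, g, hq, hg, hfg⟩ := hf h e he
  refine ContinuousAt.congr ?_ (hfg.mono fun z hz ↦ hz.symm)
  have h1 : ContinuousAt g (q (h, e).1, (h, e).2) := hg.self_of_nhds.continuousAt
  exact ContinuousAt.comp (f := fun z : X × E ↦ (q z.1, z.2)) h1
    ((ContinuousAt.comp (f := Prod.fst) hq continuousAt_fst).prodMk continuousAt_snd)

theorem LocSmoothFamily.continuous_left (hf : LocSmoothFamily Q U f) {e : E} (he : e ∈ U) :
    Continuous fun h ↦ f h e :=
  continuous_iff_continuousAt.2 fun h ↦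
    (hf.continuousAt h he).comp (f := fun h ↦ (h, e)) (by fun_prop)

theorem LocSmoothFamily.contDiffAt (hf : LocSmoothFamily Q U f) (h : X) {e : E} (he : e ∈ U) :
    ContDiffAt ℝ ∞ (f h) e := by
  obtain ⟨q, g, hq, hg, hfg⟩ := hf h e he
  have h2 : ContDiffAt ℝ ∞ (fun e' ↦ g (q h, e')) e :=
    ContDiffAt.comp e hg.self_of_nhds (contDiffAt_const.prodMk contDiffAt_id)
  refine h2.congr_of_eventuallyEq ?_
  have : Tendsto (fun e' ↦ (h, e')) (𝓝 e) (𝓝 (h, e)) := by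
    apply Continuous.tendsto; fun_prop
  exact this.eventually hfg

theorem LocSmoothFamily.fderiv (hf : LocSmoothFamily Q U f) :
    LocSmoothFamily Q U fun h e ↦ fderiv ℝ (f h) e := by
  intro h e he
  obtain ⟨q, g, hq, hg, hfg⟩ := hf h e he
  refine ⟨q, _, hq, eventually_contDiffAt_partial_fderiv hg, ?_⟩
  filter_upwards [hfg.eventually_nhds] with z hz
  apply Filter.EventuallyEq.fderiv_eq
  have : Tendsto (fun e' ↦ (z.1, e')) (𝓝 z.2) (𝓝 z) := by
    apply Continuous.tendsto; fun_prop
  exact this.eventually hz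

variable [CompactSpace X] [MeasurableSpace X] [OpensMeasurableSpace X]
  (μ : Measure X) [IsFiniteMeasure μ]

omit [NormedSpace ℝ F] in
theorem integrable_of_continuous_compact {f : X → F} (hf : Continuous f) : Integrable f μ := by
  rw [← integrableOn_univ]
  exact hf.continuousOn.integrableOn_compact' isCompact_univ MeasurableSet.univ

/-- Compactness of `X` bounds the derivatives uniformly in `h` near `e`, so a constant dominates
them. In the application `X` is an isotropy group, used only as a compact space without a manifold
structure of its own. -/
theorem LocSmoothFamily.hasFDerivAt_integral (hf : LocSmoothFamily Q U f) (hU : IsOpen U)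
    {e : E} (he : e ∈ U) :
    HasFDerivAt (fun e ↦ ∫ h, f h e ∂μ) (∫ h, _root_.fderiv ℝ (f h) e ∂μ) e := by
  have hc : Continuous fun h ↦ ‖_root_.fderiv ℝ (f h) e‖ := (hf.fderiv.continuous_left he).norm
  obtain ⟨C, hC⟩ := (isCompact_univ.image hc).bddAbove
  have hb : ∀ᶠ e' in 𝓝 e, ∀ h ∈ (univ : Set X), ‖_root_.fderiv ℝ (f h) e'‖ < C + 1 := by
    refine isCompact_univ.eventually_forall_of_forall_eventually
      (P := fun e' h ↦ ‖_root_.fderiv ℝ (f h) e'‖ < C + 1) fun h _ ↦ ?_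
    have h1 : ContinuousAt (fun z : E × X ↦ ‖_root_.fderiv ℝ (f z.2) z.1‖) (e, h) :=
      (ContinuousAt.comp (f := Prod.swap) (x := (e, h)) (hf.fderiv.continuousAt h he)
        continuous_swap.continuousAt).norm
    apply h1.eventually_lt_const
    have : ‖_root_.fderiv ℝ (f h) e‖ ≤ C := hC ⟨h, mem_univ _, rfl⟩
    simpa using this.trans_lt (lt_add_one C)
  have hs : {e' | e' ∈ U ∧ ∀ h ∈ (univ : Set X), ‖_root_.fderiv ℝ (f h) e'‖ < C + 1} ∈ 𝓝 e := by
    filter_upwards [hU.mem_nhds he, hb] with e' h1 h2 using ⟨h1, h2⟩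
  refine hasFDerivAt_integral_of_dominated_of_fderiv_le (𝕜 := ℝ)
    (F := fun e h ↦ f h e) (F' := fun e h ↦ _root_.fderiv ℝ (f h) e) (bound := fun _ ↦ C + 1) hs ?_ ?_ ?_ ?_ ?_ ?_
  · filter_upwards [hU.mem_nhds he] with e' he'
    exact (integrable_of_continuous_compact μ (hf.continuous_left he')).aestronglyMeasurable
  · exact integrable_of_continuous_compact μ (hf.continuous_left he)
  · exact (integrable_of_continuous_compact μ (hf.fderiv.continuous_left he)).aestronglyMeasurable
  · exact ae_of_all _ fun h e' he' ↦ (he'.2 h (mem_univ _)).le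
  · exact integrable_const _
  · exact ae_of_all _ fun h e' he' ↦
      ((hf.contDiffAt h he'.1).differentiableAt (by simp)).hasFDerivAt

end Calculus

/-- Smoothness of an integral that depends on parameters. -/
theorem LocSmoothFamily.contDiffOn_integral_nat {E : Type u} [NormedAddCommGroup E]
    [NormedSpace ℝ E] {Q : Type*} [NormedAddCommGroup Q] [NormedSpace ℝ Q]
    {X : Type*} [TopologicalSpace X] {U : Set E}
    [CompactSpace X] [MeasurableSpace X] [OpensMeasurableSpace X] (μ : Measure X)
    [IsFiniteMeasure μ] (hU : IsOpen U) (n : ℕ) :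
    ∀ (F : Type u) [NormedAddCommGroup F] [NormedSpace ℝ F] (f : X → E → F)
    (_ : LocSmoothFamily Q U f),
    ContDiffOn ℝ n (fun e ↦ ∫ h, f h e ∂μ) U := by
  -- `F` is quantified inside the induction because the step replaces it by `E →L[ℝ] F`; this is
  -- also why `E` and `F` share a universe.
  induction n with
  | zero =>
    intro F _ _ f hf
    exact contDiffOn_zero.2 fun e he ↦
      (hf.hasFDerivAt_integral μ hU he).continuousAt.continuousWithinAt
  | succ n ih =>
    intro F _ _ f hf
    have h := ih (E →L[ℝ] F) (fun h e ↦ _root_.fderiv ℝ (f h) e) hf.fderiv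
    push_cast
    refine (contDiffOn_succ_iff_fderiv_of_isOpen hU).2 ⟨fun e he ↦
      (hf.hasFDerivAt_integral μ hU he).differentiableAt.differentiableWithinAt, by simp, ?_⟩
    exact h.congr fun e he ↦ (hf.hasFDerivAt_integral μ hU he).fderiv

theorem LocSmoothFamily.contDiffOn_integral {E : Type u} [NormedAddCommGroup E]
    [NormedSpace ℝ E] {Q : Type*} [NormedAddCommGroup Q] [NormedSpace ℝ Q]
    {X : Type*} [TopologicalSpace X] {U : Set E}
    [CompactSpace X] [MeasurableSpace X] [OpensMeasurableSpace X] (μ : Measure X)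
    [IsFiniteMeasure μ] (hU : IsOpen U) {F : Type u} [NormedAddCommGroup F] [NormedSpace ℝ F]
    {f : X → E → F} (hf : LocSmoothFamily Q U f) :
    ContDiffOn ℝ ∞ (fun e ↦ ∫ h, f h e ∂μ) U :=
  contDiffOn_infty.2 fun n ↦ contDiffOn_integral_nat μ hU n F f hf

/-! ### Charts centered at a point -/

section Centered

variable (E : Type*) [NormedAddCommGroup E] [NormedSpace ℝ E]
  {X : Type*} [TopologicalSpace X] [ChartedSpace E X]

/-- The inverse of the preferred chart at `x`, translated so that `0` is sent to `x`. -/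
noncomputable def par (x : X) (v : E) : X :=
  (extChartAt 𝓘(ℝ, E) x).symm (extChartAt 𝓘(ℝ, E) x x + v)

/-- The preferred chart at `x`, translated so that `x` is sent to `0`. -/
noncomputable def co (x y : X) : E :=
  extChartAt 𝓘(ℝ, E) x y - extChartAt 𝓘(ℝ, E) x x

/-- The domain of the preferred chart at `x`. -/
def src (x : X) : Set X := (extChartAt 𝓘(ℝ, E) x).source

@[simp] theorem par_zero (x : X) : par E x 0 = x := by simp [par]

@[simp] theorem co_self (x : X) : co E x x = 0 := by simp [co]

variable {E}

theorem par_co {x y : X} (hy : y ∈ src E x) : par E x (co E x y) = y := by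
  simp only [par, co, add_sub_cancel]
  exact (extChartAt 𝓘(ℝ, E) x).left_inv hy

theorem isOpen_src (x : X) : IsOpen (src E x) := isOpen_extChartAt_source x

theorem mem_src_self (x : X) : x ∈ src E x := mem_extChartAt_source x

theorem src_mem_nhds (x : X) : src E x ∈ 𝓝 x := (isOpen_src x).mem_nhds (mem_src_self x)

theorem co_injOn {x y z : X} (hy : y ∈ src E x) (hz : z ∈ src E x) (h : co E x y = co E x z) :
    y = z := by
  rw [← par_co hy, ← par_co hz, h]

theorem eventually_mem_target {x y : X} (hy : y ∈ src E x) :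
    ∀ᶠ v in 𝓝 (co E x y), extChartAt 𝓘(ℝ, E) x x + v ∈ (extChartAt 𝓘(ℝ, E) x).target := by
  have h1 : Tendsto (fun v ↦ extChartAt 𝓘(ℝ, E) x x + v) (𝓝 (co E x y))
      (𝓝 (extChartAt 𝓘(ℝ, E) x y)) := by
    have : Continuous fun v ↦ extChartAt 𝓘(ℝ, E) x x + v := by fun_prop
    simpa [co] using this.tendsto (co E x y)
  exact h1 ((isOpen_extChartAt_target x).mem_nhds ((extChartAt 𝓘(ℝ, E) x).map_source hy))

theorem eventually_co_par' {x y : X} (hy : y ∈ src E x) :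
    ∀ᶠ v in 𝓝 (co E x y), co E x (par E x v) = v ∧ par E x v ∈ src E x := by
  filter_upwards [eventually_mem_target hy] with v hv
  refine ⟨?_, (extChartAt 𝓘(ℝ, E) x).map_target hv⟩
  rw [co, par, (extChartAt 𝓘(ℝ, E) x).right_inv hv, add_sub_cancel_left]

theorem eventually_co_par (x : X) :
    ∀ᶠ v in 𝓝 0, co E x (par E x v) = v ∧ par E x v ∈ src E x := by
  simpa using eventually_co_par' (mem_src_self (E := E) x)

variable [IsManifold 𝓘(ℝ, E) ∞ X]

theorem contMDiffAt_co {x y : X} (hy : y ∈ src E x) :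
    ContMDiffAt 𝓘(ℝ, E) 𝓘(ℝ, E) ∞ (co E x) y := by
  have h : ContMDiffAt 𝓘(ℝ, E) 𝓘(ℝ, E) ∞ (extChartAt 𝓘(ℝ, E) x) y :=
    contMDiffAt_extChartAt' (by simpa [src] using hy)
  exact h.sub contMDiffAt_const

theorem contMDiffAt_par {x y : X} (hy : y ∈ src E x) :
    ContMDiffAt 𝓘(ℝ, E) 𝓘(ℝ, E) ∞ (par E x) (co E x y) := by
  have h := (contMDiffOn_extChartAt_symm (I := 𝓘(ℝ, E)) (n := ∞) x).contMDiffAt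
    ((isOpen_extChartAt_target x).mem_nhds ((extChartAt 𝓘(ℝ, E) x).map_source hy))
  have h2 : ContMDiffAt 𝓘(ℝ, E) 𝓘(ℝ, E) ∞ (fun v ↦ extChartAt 𝓘(ℝ, E) x x + v) (co E x y) :=
    contMDiffAt_const.add contMDiffAt_id
  exact h.comp_of_eq h2 (by simp [co])

end Centered

/-! ### Smoothness on a neighbourhood of a point -/

section SmoothNear

variable (E F : Type*) [NormedAddCommGroup E] [NormedSpace ℝ E]
  [NormedAddCommGroup F] [NormedSpace ℝ F]
  {X Y : Type*} [TopologicalSpace X] [ChartedSpace E X] [TopologicalSpace Y] [ChartedSpace F Y]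

/-- The map `f` is smooth on a neighbourhood of `x`. -/
def SmoothNear (f : X → Y) (x : X) : Prop :=
  ∀ᶠ y in 𝓝 x, ContMDiffAt 𝓘(ℝ, E) 𝓘(ℝ, F) ∞ f y

variable {E F}

theorem smoothNear_vec_iff {f : E → F} {x : E} :
    SmoothNear E F f x ↔ ∀ᶠ y in 𝓝 x, ContDiffAt ℝ ∞ f y := by
  simp only [SmoothNear, contMDiffAt_iff_contDiffAt]

theorem SmoothNear.at {f : X → Y} {x : X} (hf : SmoothNear E F f x) :
    ContMDiffAt 𝓘(ℝ, E) 𝓘(ℝ, F) ∞ f x := hf.self_of_nhds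

theorem SmoothNear.continuousAt {f : X → Y} {x : X} (hf : SmoothNear E F f x) :
    ContinuousAt f x := hf.at.continuousAt

theorem SmoothNear.eventually {f : X → Y} {x : X} (hf : SmoothNear E F f x) :
    ∀ᶠ y in 𝓝 x, SmoothNear E F f y := eventually_eventually_nhds.2 hf

theorem SmoothNear.differentiableAt {f : E → F} {x : E} (hf : SmoothNear E F f x) :
    DifferentiableAt ℝ f x :=
  (contMDiffAt_iff_contDiffAt.1 hf.at).differentiableAt (by simp)

theorem SmoothNear.comp {G Z : Type*} [NormedAddCommGroup G] [NormedSpace ℝ G]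
    [TopologicalSpace Z] [ChartedSpace G Z] {g : Y → Z} {f : X → Y} {x : X}
    (hg : SmoothNear F G g (f x)) (hf : SmoothNear E F f x) :
    SmoothNear E G (fun z ↦ g (f z)) x := by
  filter_upwards [hf, hf.continuousAt.eventually hg] with y h1 h2
  exact ContMDiffAt.comp y h2 h1

theorem SmoothNear.comp_of_eq {G Z : Type*} [NormedAddCommGroup G] [NormedSpace ℝ G]
    [TopologicalSpace Z] [ChartedSpace G Z] {g : Y → Z} {f : X → Y} {x : X} {y : Y}
    (hg : SmoothNear F G g y) (hf : SmoothNear E F f x) (h : f x = y) :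
    SmoothNear E G (fun z ↦ g (f z)) x := by
  subst h; exact hg.comp hf

theorem SmoothNear.congr {f g : X → Y} {x : X} (hf : SmoothNear E F f x) (h : g =ᶠ[𝓝 x] f) :
    SmoothNear E F g x := by
  filter_upwards [hf, h.eventually_nhds] with y h1 h2 using h1.congr_of_eventuallyEq h2

theorem smoothNear_of_contMDiff {f : X → Y} (hf : ContMDiff 𝓘(ℝ, E) 𝓘(ℝ, F) ∞ f) (x : X) :
    SmoothNear E F f x := Eventually.of_forall fun y ↦ hf y

theorem smoothNear_of_contDiff {f : E → F} (hf : ContDiff ℝ ∞ f) (x : E) :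
    SmoothNear E F f x := smoothNear_of_contMDiff hf.contMDiff x

theorem smoothNear_const (y : Y) (x : X) : SmoothNear E F (fun _ : X ↦ y) x :=
  smoothNear_of_contMDiff contMDiff_const x

theorem smoothNear_id (x : X) : SmoothNear E E (fun y : X ↦ y) x :=
  smoothNear_of_contMDiff contMDiff_id x

theorem SmoothNear.prodMk {G : Type*} [NormedAddCommGroup G] [NormedSpace ℝ G]
    {f : X → F} {g : X → G} {x : X} (hf : SmoothNear E F f x) (hg : SmoothNear E G g x) :
    SmoothNear E (F × G) (fun y ↦ (f y, g y)) x := by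
  filter_upwards [hf, hg] with y h1 h2 using h1.prodMk_space h2

theorem smoothNear_co [IsManifold 𝓘(ℝ, E) ∞ X] {x y : X} (hy : y ∈ src E x) :
    SmoothNear E E (co E x) y := by
  filter_upwards [(isOpen_src x).mem_nhds hy] with z hz using contMDiffAt_co hz

theorem smoothNear_par [IsManifold 𝓘(ℝ, E) ∞ X] {x y : X} (hy : y ∈ src E x) :
    SmoothNear E E (par E x) (co E x y) := by
  filter_upwards [eventually_co_par' hy] with v hv
  rw [← hv.1]
  exact contMDiffAt_par hv.2

theorem smoothNear_par_zero [IsManifold 𝓘(ℝ, E) ∞ X] (x : X) :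
    SmoothNear E E (par E x) 0 := by
  simpa using smoothNear_par (mem_src_self (E := E) x)

theorem SmoothNear.smul {G A : Type*} [NormedAddCommGroup G] [NormedSpace ℝ G]
    [TopologicalSpace A] [ChartedSpace G A] [Group A] [MulAction A Y]
    [ContMDiffSMul 𝓘(ℝ, G) 𝓘(ℝ, F) ∞ A Y] {f : X → A} {g : X → Y} {x : X}
    (hf : SmoothNear E G f x) (hg : SmoothNear E F g x) :
    SmoothNear E F (fun y ↦ f y • g y) x := by
  filter_upwards [hf, hg] with y h1 h2
  exact ContMDiffAt.smul (I := 𝓘(ℝ, G)) (I' := 𝓘(ℝ, F)) h1 h2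

theorem SmoothNear.mul [Group Y] [LieGroup 𝓘(ℝ, F) ∞ Y] {f g : X → Y} {x : X}
    (hf : SmoothNear E F f x) (hg : SmoothNear E F g x) :
    SmoothNear E F (fun y ↦ f y * g y) x := by
  filter_upwards [hf, hg] with y h1 h2 using ContMDiffAt.mul h1 h2

theorem SmoothNear.inv [Group Y] [LieGroup 𝓘(ℝ, F) ∞ Y] {f : X → Y} {x : X}
    (hf : SmoothNear E F f x) : SmoothNear E F (fun y ↦ (f y)⁻¹) x := by
  filter_upwards [hf] with y h1 using ContMDiffAt.inv h1

theorem eventually_eq_of_fderiv_eq_zero {f : E → F} {x : E}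
    (h : ∀ᶠ y in 𝓝 x, HasFDerivAt f (0 : E →L[ℝ] F) y) : ∀ᶠ y in 𝓝 x, f y = f x := by
  obtain ⟨r, hr, hb⟩ := Metric.eventually_nhds_iff_ball.1 h
  filter_upwards [Metric.ball_mem_nhds x hr] with y hy
  refine (convex_ball x r).is_const_of_fderivWithin_eq_zero (𝕜 := ℝ)
    (fun z hz ↦ (hb z hz).differentiableAt.differentiableWithinAt) (fun z hz ↦ ?_)
    hy (Metric.mem_ball_self hr)
  rw [fderivWithin_of_isOpen Metric.isOpen_ball hz]
  exact (hb z hz).fderiv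

/-- Chain rule for a map that factors near a point. -/
theorem fderiv_eq_comp_of_eventuallyEq {G : Type*} [NormedAddCommGroup G] [NormedSpace ℝ G]
    {f : E → G} {g : F → G} {h : E → F} {x : E} {y : F} (hf : f =ᶠ[𝓝 x] fun z ↦ g (h z))
    (hxy : h x = y) (hg : SmoothNear F G g y) (hh : SmoothNear E F h x) :
    fderiv ℝ f x = (fderiv ℝ g y).comp (fderiv ℝ h x) := by
  subst hxy
  rw [hf.fderiv_eq]
  exact fderiv_comp x hg.differentiableAt hh.differentiableAt

end SmoothNear

theorem smoothNear_const_smul (EA : Type*) [NormedAddCommGroup EA] [NormedSpace ℝ EA] {EM : Type*}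
    [NormedAddCommGroup EM] [NormedSpace ℝ EM] {A : Type*} [TopologicalSpace A] [ChartedSpace EA A]
    [Group A] {M : Type*} [TopologicalSpace M] [ChartedSpace EM M] [MulAction A M]
    [ContMDiffSMul 𝓘(ℝ, EA) 𝓘(ℝ, EM) ∞ A M] (k : A) (y : M) : SmoothNear EM EM (fun z : M ↦ k • z) y :=
  smoothNear_of_contMDiff (ContMDiffSMul.contMDiff_const_smul (I := 𝓘(ℝ, EA)) k) y

/-- By injectivity `L` maps `m × 0` onto a subspace of `R` of dimension at least that of `R`, hence
onto `R`. So `L (T v)` comes from `m × 0`, and injectivity again identifies `T v`. This is the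
linear algebra behind the last clause of `exists_tube`. -/
theorem snd_eq_zero_of_range_le {P m N EM : Type*} [AddCommGroup P] [Module ℝ P]
    [AddCommGroup m] [Module ℝ m] [FiniteDimensional ℝ m] [AddCommGroup N] [Module ℝ N]
    [AddCommGroup EM] [Module ℝ EM] [FiniteDimensional ℝ EM] {L : m × N →ₗ[ℝ] EM}
    (hL : Function.Injective L) {T : P →ₗ[ℝ] m × N} {R : Submodule ℝ EM}
    (h1 : ∀ a, L (a, 0) ∈ R) (h2 : Module.finrank ℝ R ≤ Module.finrank ℝ m)
    (h3 : ∀ v, L (T v) ∈ R) (v : P) : (T v).2 = 0 := by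
  have hinj : Function.Injective (L.comp (LinearMap.inl ℝ m N)) :=
    hL.comp LinearMap.inl_injective
  have hle : (L.comp (LinearMap.inl ℝ m N)).range ≤ R := by
    rintro _ ⟨a, rfl⟩; exact h1 a
  have heq := Submodule.eq_of_le_of_finrank_le hle
    (by rwa [LinearMap.finrank_range_of_inj hinj])
  have : L (T v) ∈ (L.comp (LinearMap.inl ℝ m N)).range := heq ▸ h3 v
  obtain ⟨a, ha⟩ := this
  rw [← hL ha]; rfl

/-! ### The tubular map around an orbit -/

section Tube

variable (EA EM : Type*) [NormedAddCommGroup EA] [NormedSpace ℝ EA]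
  [NormedAddCommGroup EM] [NormedSpace ℝ EM]
  (A : Type*) [TopologicalSpace A] [ChartedSpace EA A] [Group A]
  {M : Type*} [TopologicalSpace M] [ChartedSpace EM M] [MulAction A M]

/-- The derivative at the identity of the orbit map of `y`, in the chart centered at `x`. -/
noncomputable def orbD (x y : M) : EA →L[ℝ] EM :=
  fderiv ℝ (fun a : EA ↦ co EM x (par EA (1 : A) a • y)) 0

variable {EA EM A}
  [LieGroup 𝓘(ℝ, EA) ∞ A] [IsManifold 𝓘(ℝ, EM) ∞ M] [ContMDiffSMul 𝓘(ℝ, EA) 𝓘(ℝ, EM) ∞ A M]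

theorem smoothNear_orbit_chart {x y : M} (hy : y ∈ src EM x) :
    SmoothNear EA EM (fun a : EA ↦ co EM x (par EA (1 : A) a • y)) 0 :=
  (smoothNear_co (by simpa)).comp ((smoothNear_par_zero (1 : A)).smul (smoothNear_const y 0))

/-- Derivative of a map that moves `y` along its orbit. -/
theorem fderiv_co_smul {P : Type*} [NormedAddCommGroup P] [NormedSpace ℝ P]
    {x y : M} (hy : y ∈ src EM x) {θ : P → A} {p : P} (hθ : SmoothNear P EA θ p) (h1 : θ p = 1) :
    fderiv ℝ (fun q ↦ co EM x (θ q • y)) p =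
      (orbD EA EM A x y).comp (fderiv ℝ (fun q ↦ co EA 1 (θ q)) p) := by
  have hco : SmoothNear P EA (fun q ↦ co EA 1 (θ q)) p :=
    (smoothNear_co (by simpa [h1] using mem_src_self (E := EA) (1 : A))).comp hθ
  refine fderiv_eq_comp_of_eventuallyEq (g := fun a : EA ↦ co EM x (par EA (1 : A) a • y)) ?_
    (by simp [h1]) (smoothNear_orbit_chart hy) hco
  have hev : ∀ᶠ q in 𝓝 p, θ q ∈ src EA (1 : A) :=
    hθ.continuousAt (by rw [h1]; exact src_mem_nhds 1)
  filter_upwards [hev] with q hq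
  simp only [par_co hq]

variable [FiniteDimensional ℝ EA] [FiniteDimensional ℝ EM]

/-- The tubular map at `x`: near `x`, every point is moved by some `c y` to a point of the
transversal `σ(N)`; a map that is everywhere tangent to orbits of dimension at most that of the
orbit of `x` stays in the orbit of `x`. -/
theorem exists_tube (x : M) {σ : EM → M} (hσ : SmoothNear EM EM σ 0) (hσ0 : σ 0 = x)
    (hσ' : HasFDerivAt (fun n ↦ co EM x (σ n)) (ContinuousLinearMap.id ℝ EM) 0)
    {N : Submodule ℝ EM} (hN : IsCompl (orbD EA EM A x x).range N) :
    ∃ (c : M → A) (s : M → EM), SmoothNear EM EA c x ∧ c x = 1 ∧ SmoothNear EM EM s x ∧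
      s x = 0 ∧ (∀ y, s y ∈ N) ∧ (∀ᶠ y in 𝓝 x, c y • σ (s y) = y) ∧
      (∀ᶠ z : M × EM in 𝓝 (x, 0), z.2 ∈ N →
        c (c z.1 • σ z.2) = c z.1 ∧ s (c z.1 • σ z.2) = z.2) ∧
      ∀ β : EA → M, SmoothNear EA EM β 0 → β 0 = x →
        (∀ᶠ p in 𝓝 0, (fderiv ℝ (fun q ↦ co EM x (β q)) p).range ≤
            (orbD EA EM A x (β p)).range ∧
          Module.finrank ℝ (orbD EA EM A x (β p)).range ≤
            Module.finrank ℝ (orbD EA EM A x x).range) →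
        ∀ᶠ p in 𝓝 0, s (β p) = 0 := by
  have : CompleteSpace EA := FiniteDimensional.complete ℝ EA
  have : CompleteSpace EM := FiniteDimensional.complete ℝ EM
  set D := orbD EA EM A x x with hD
  -- On a complement of the kernel the orbit directions are parametrized without redundancy, so that
  -- `F` below has the bijective derivative `(a, n) ↦ D a + n`.
  obtain ⟨m, hm⟩ := Submodule.exists_isCompl D.ker
  let F : m × N → EM := fun z ↦ co EM x (par EA (1 : A) (z.1 : EA) • σ (z.2 : EM))
  have hF0 : F 0 = 0 := by simp [F, hσ0]
  -- smoothness of the pieces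
  have hfst : ∀ z, SmoothNear (m × N) EA (fun z : m × N ↦ (z.1 : EA)) z := fun z ↦
    smoothNear_of_contMDiff (contMDiff_iff_contDiff.2
      (m.subtypeL.comp (ContinuousLinearMap.fst ℝ m N)).contDiff) z
  have hsnd : ∀ z, SmoothNear (m × N) EM (fun z : m × N ↦ (z.2 : EM)) z := fun z ↦
    smoothNear_of_contMDiff (contMDiff_iff_contDiff.2
      (N.subtypeL.comp (ContinuousLinearMap.snd ℝ m N)).contDiff) z
  have hk : SmoothNear (m × N) EA (fun z : m × N ↦ par EA (1 : A) (z.1 : EA)) 0 :=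
    (smoothNear_par_zero (1 : A)).comp_of_eq (hfst 0) rfl
  have hs : SmoothNear (m × N) EM (fun z : m × N ↦ σ (z.2 : EM)) 0 :=
    hσ.comp_of_eq (hsnd 0) rfl
  have hks : SmoothNear (m × N) EM (fun z : m × N ↦ par EA (1 : A) (z.1 : EA) • σ (z.2 : EM)) 0 :=
    hk.smul hs
  have hks0 : par EA (1 : A) (((0 : m × N).1 : m) : EA) • σ (((0 : m × N).2 : N) : EM) = x := by
    simp [hσ0]
  have hF : SmoothNear (m × N) EM F 0 :=
    (smoothNear_co (mem_src_self x)).comp_of_eq hks hks0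
  -- the derivative of `F` at `0`
  have hF1 : ∀ a : m, fderiv ℝ F 0 (a, 0) = D a := by
    intro a
    have h0 : HasFDerivAt F (fderiv ℝ F 0) (ContinuousLinearMap.inl ℝ m N 0) :=
      hF.differentiableAt.hasFDerivAt
    have h1 : HasFDerivAt (fun b : m ↦ F (b, 0)) ((fderiv ℝ F 0).comp
        (ContinuousLinearMap.inl ℝ m N)) 0 :=
      h0.comp (0 : m) (ContinuousLinearMap.inl ℝ m N).hasFDerivAt
    have h2 : HasFDerivAt (fun b : m ↦ F (b, 0)) (D.comp m.subtypeL) 0 := by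
      have h3 : HasFDerivAt (fun a : EA ↦ co EM x (par EA (1 : A) a • x)) D (m.subtypeL 0) :=
        (smoothNear_orbit_chart (mem_src_self x)).differentiableAt.hasFDerivAt
      have := h3.comp (0 : m) m.subtypeL.hasFDerivAt
      simpa [F, hσ0, Function.comp_def] using this
    have := congrArg (fun T ↦ T a) (h1.unique h2)
    simpa using this
  have hF2 : ∀ n : N, fderiv ℝ F 0 (0, n) = n := by
    intro n
    have h0 : HasFDerivAt F (fderiv ℝ F 0) (ContinuousLinearMap.inr ℝ m N 0) :=
      hF.differentiableAt.hasFDerivAt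
    have h1 : HasFDerivAt (fun b : N ↦ F (0, b)) ((fderiv ℝ F 0).comp
        (ContinuousLinearMap.inr ℝ m N)) 0 :=
      h0.comp (0 : N) (ContinuousLinearMap.inr ℝ m N).hasFDerivAt
    have h2 : HasFDerivAt (fun b : N ↦ F (0, b)) N.subtypeL 0 := by
      have h3 : HasFDerivAt (fun n ↦ co EM x (σ n)) (ContinuousLinearMap.id ℝ EM)
        (N.subtypeL 0) := hσ'
      have := h3.comp (0 : N) N.subtypeL.hasFDerivAt
      simpa [F, Function.comp_def] using this
    have := congrArg (fun T ↦ T n) (h1.unique h2)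
    simpa using this
  have hF12 : ∀ z : m × N, fderiv ℝ F 0 z = D z.1 + z.2 := by
    intro z
    have : z = (z.1, 0) + (0, z.2) := by simp
    rw [this, map_add, hF1, hF2]; simp
  have hinj : Function.Injective (fderiv ℝ F 0) := by
    rw [injective_iff_map_eq_zero]
    rintro ⟨a, n⟩ h
    rw [hF12] at h
    have h1 : D a ∈ D.range ⊓ N := by
      refine ⟨⟨a, rfl⟩, ?_⟩
      have : D a = -(n : EM) := eq_neg_of_add_eq_zero_left h
      rw [this]; exact N.neg_mem n.2
    rw [hN.inf_eq_bot, Submodule.mem_bot] at h1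
    have h2 : (a : EA) ∈ D.ker ⊓ m := ⟨h1, a.2⟩
    rw [hm.inf_eq_bot, Submodule.mem_bot] at h2
    simp only [h2, map_zero, zero_add] at h
    ext <;> simp [h2, h]
  have hsurj : Function.Surjective (fderiv ℝ F 0) := by
    intro y
    obtain ⟨_, ⟨a, rfl⟩, n, hn, rfl⟩ := Submodule.mem_sup.1
      (hN.sup_eq_top ▸ Submodule.mem_top : y ∈ D.range ⊔ N)
    obtain ⟨k, hk, b, hb, rfl⟩ := Submodule.mem_sup.1
      (hm.sup_eq_top ▸ Submodule.mem_top : a ∈ D.ker ⊔ m)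
    refine ⟨(⟨b, hb⟩, ⟨n, hn⟩), ?_⟩
    rw [hF12]
    have : D k = 0 := hk
    simp [this]
  let L₀ : (m × N) ≃L[ℝ] EM := (LinearEquiv.ofBijective (fderiv ℝ F 0 : (m × N) →ₗ[ℝ] EM)
    ⟨hinj, hsurj⟩).toContinuousLinearEquiv
  have hL₀ : HasFDerivAt F (L₀ : (m × N) →L[ℝ] EM) 0 := by
    have : (L₀ : (m × N) →L[ℝ] EM) = fderiv ℝ F 0 := by ext z <;> rfl
    rw [this]; exact hF.differentiableAt.hasFDerivAt
  obtain ⟨g, hg0, hg, hgF, hFg⟩ := exists_smooth_local_inverse (smoothNear_vec_iff.1 hF) hL₀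
  rw [hF0] at hg0 hg hFg
  have hg : SmoothNear EM (m × N) g 0 := smoothNear_vec_iff.2 hg
  have hgco : SmoothNear EM (m × N) (fun y ↦ g (co EM x y)) x :=
    hg.comp_of_eq (smoothNear_co (mem_src_self x)) (by simp)
  have hgx : g (co EM x x) = 0 := by simp [hg0]
  have hrec : ∀ᶠ y in 𝓝 x, par EA (1 : A) ((g (co EM x y)).1 : EA) •
      σ ((g (co EM x y)).2 : EM) = y := by
    have h1 : Tendsto (co EM x) (𝓝 x) (𝓝 0) := by
      simpa [ContinuousAt] using (smoothNear_co (mem_src_self (E := EM) x)).continuousAt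
    have h2 : Tendsto (fun y ↦ g (co EM x y)) (𝓝 x) (𝓝 0) := by
      simpa [ContinuousAt, hg0] using hgco.continuousAt
    have h3 : ∀ᶠ z in 𝓝 (0 : m × N), par EA (1 : A) (z.1 : EA) • σ (z.2 : EM) ∈ src EM x :=
      hks.continuousAt (by rw [hks0]; exact src_mem_nhds x)
    filter_upwards [h1.eventually hFg, src_mem_nhds (E := EM) x, h2.eventually h3] with y h4 h5 h6
    exact co_injOn h6 h5 h4
  -- The two components of the local inverse of `F` give the group element `c` and the transversal
  -- coordinate `s`.
  refine ⟨fun y ↦ par EA (1 : A) ((g (co EM x y)).1 : EA), fun y ↦ ((g (co EM x y)).2 : EM),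
    ?_, ?_, ?_, ?_, fun y ↦ (g (co EM x y)).2.2, hrec, ?_, ?_⟩
  · exact hk.comp_of_eq hgco hgx
  · simp [hg0]
  · exact (hsnd 0).comp_of_eq hgco hgx
  · simp [hg0]
  · have h1 : ∀ᶠ w in 𝓝 ((0, 0) : m × N), g (F w) = w := hgF
    rw [nhds_prod_eq] at h1
    obtain ⟨pa, hpa, pn, hpn, h2⟩ := eventually_prod_iff.1 h1
    have h3 : ∀ᶠ y in 𝓝 x, pa (g (co EM x y)).1 := by
      have h4 : Tendsto (fun y ↦ (g (co EM x y)).1) (𝓝 x) (𝓝 0) := by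
        have := continuous_fst.continuousAt.comp hgco.continuousAt
        simpa [ContinuousAt, hg0, Function.comp_def] using this
      exact h4.eventually hpa
    rw [nhds_subtype_eq_comap, eventually_comap] at hpn
    rw [nhds_prod_eq]
    refine (h3.prod_mk hpn).mono ?_
    rintro ⟨y, n⟩ ⟨hy, hn⟩ hnN
    have h5 := h2 hy (hn ⟨n, hnN⟩ rfl)
    change g (co EM x (par EA (1 : A) ((g (co EM x y)).1 : EA) • σ n)) = _ at h5
    simp only [h5, and_self]
  · intro β hβ hβ0 hev
    have hcoβ : SmoothNear EA EM (fun q ↦ co EM x (β q)) 0 :=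
      (smoothNear_co (mem_src_self x)).comp_of_eq hβ hβ0
    have hψ : SmoothNear EA (m × N) (fun q ↦ g (co EM x (β q))) 0 :=
      hg.comp_of_eq hcoβ (by simp [hβ0])
    have hψ0 : g (co EM x (β 0)) = 0 := by rw [hβ0, hgx]
    have hψt : Tendsto (fun q ↦ g (co EM x (β q))) (𝓝 0) (𝓝 0) := by
      have := hψ.continuousAt
      rwa [ContinuousAt, hψ0] at this
    have hβt : Tendsto β (𝓝 0) (𝓝 x) := by
      have := hβ.continuousAt
      rwa [ContinuousAt, hβ0] at this
    have hcot : Tendsto (fun q ↦ co EM x (β q)) (𝓝 0) (𝓝 0) := by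
      have := hcoβ.continuousAt
      simpa [ContinuousAt, hβ0] using this
    have key : ∀ᶠ p in 𝓝 0, HasFDerivAt (fun q ↦ (g (co EM x (β q))).2) (0 : EA →L[ℝ] N) p := by
      have hksrc : ∀ᶠ z in 𝓝 (0 : m × N), par EA (1 : A) (z.1 : EA) • σ (z.2 : EM) ∈ src EM x :=
        hks.continuousAt (by rw [hks0]; exact src_mem_nhds x)
      filter_upwards [hev, hβt.eventually hrec.eventually_nhds,
        hβt.eventually ((isOpen_src (E := EM) x).eventually_mem (mem_src_self x)),
        hψ.eventually, hcoβ.eventually, hψt.eventually hF.eventually, hψt.eventually hk.eventually,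
        hψt.eventually hgF.eventually_nhds, hcot.eventually hg.eventually,
        hcot.eventually hFg.eventually_nhds]
        with p ⟨hp1, hp2⟩ hprec hpsrc hpψ hpco hpF hpk hpgF hpg hpFg
      set z := g (co EM x (β p)) with hz
      have hFz : F z = co EM x (β p) := hpFg.self_of_nhds
      have hLinj : Function.Injective (fderiv ℝ F z) := by
        have h1 := fderiv_eq_comp_of_eventuallyEq (f := fun w : m × N ↦ w) (g := g) (h := F)
          (hpgF.mono fun w hw ↦ hw.symm) hFz hpg hpF
        intro u w huw
        have h2 : ∀ u, fderiv ℝ (fun w : m × N ↦ w) z u = u := by simp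
        rw [← h2 u, ← h2 w, h1]
        simp [huw]
      have hT := fderiv_eq_comp_of_eventuallyEq (f := fun q ↦ co EM x (β q))
        (g := F) (h := fun q ↦ g (co EM x (β q))) (x := p)
        ((hpco.continuousAt.eventually hpFg).mono fun q hq ↦ hq.symm) rfl hpF hpψ
      have hrank : Module.finrank ℝ D.range = Module.finrank ℝ m := by
        have h1 := LinearMap.finrank_range_add_finrank_ker (D : EA →ₗ[ℝ] EM)
        have h2 := Submodule.finrank_add_eq_of_isCompl hm
        have h3 : Module.finrank ℝ D.ker = Module.finrank ℝ (D : EA →ₗ[ℝ] EM).ker := rfl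
        omega
      -- In the coordinates of `F`, the directions of `m` are tangent to orbits. Since the orbit of
      -- `β p` has dimension at most that of `m`, they fill its whole tangent space. The derivative
      -- of `β` lies there, so it has no component along `N`.
      have hT2 : ∀ v, (fderiv ℝ (fun q ↦ g (co EM x (β q))) p v).2 = 0 := by
        refine snd_eq_zero_of_range_le (L := (fderiv ℝ F z : m × N →ₗ[ℝ] EM))
          (T := (fderiv ℝ (fun q ↦ g (co EM x (β q))) p : EA →ₗ[ℝ] m × N))
          (R := (orbD EA EM A x (β p)).range) hLinj ?_ (hp2.trans hrank.le) ?_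
        · intro a
          have hinl : SmoothNear m (m × N) (fun b : m ↦ (b, z.2)) z.1 :=
            smoothNear_of_contDiff (by fun_prop) _
          -- Varying the first coordinate moves `β p` by this group element, which is `1` at `b =
          -- z.1`.
          have hθ : SmoothNear m EA
              (fun b : m ↦ par EA (1 : A) (b : EA) * (par EA (1 : A) (z.1 : EA))⁻¹) z.1 :=
            (hpk.comp_of_eq hinl rfl).mul (smoothNear_const _ _)
          have h1 := fderiv_co_smul hpsrc hθ (by simp)
          have h2 := fderiv_eq_comp_of_eventuallyEq (f := fun b : m ↦ F (b, z.2)) (g := F)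
            (h := fun b : m ↦ (b, z.2)) (x := z.1) EventuallyEq.rfl rfl hpF hinl
          have h3 : (fun b : m ↦ F (b, z.2)) = fun b : m ↦ co EM x
              ((par EA (1 : A) (b : EA) * (par EA (1 : A) (z.1 : EA))⁻¹) • β p) := by
            funext b
            simp only [F]
            rw [← hprec.self_of_nhds, smul_smul, inv_mul_cancel_right]
          have h4 : fderiv ℝ (fun b : m ↦ (b, z.2)) z.1 a = (a, 0) := by
            have : HasFDerivAt (fun b : m ↦ (b, z.2))
              ((ContinuousLinearMap.id ℝ m).prod 0) z.1 :=
              (hasFDerivAt_id _).prodMk (hasFDerivAt_const _ _)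
            rw [this.fderiv]; rfl
          rw [h3, h1] at h2
          have h5 := congrArg (fun T ↦ T a) h2
          simp only [ContinuousLinearMap.comp_apply, h4] at h5
          exact ⟨_, h5⟩
        · intro v
          apply hp1
          exact ⟨v, congrArg (fun T ↦ T v) hT⟩
      have h1 : HasFDerivAt (fun q ↦ (g (co EM x (β q))).2)
          ((ContinuousLinearMap.snd ℝ m N).comp (fderiv ℝ (fun q ↦ g (co EM x (β q))) p)) p :=
        (ContinuousLinearMap.snd ℝ m N).hasFDerivAt.comp p hpψ.differentiableAt.hasFDerivAt
      convert h1 using 1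
      ext v
      simp [hT2 v]
    refine (eventually_eq_of_fderiv_eq_zero key).mono fun p hp ↦ ?_
    change ((g (co EM x (β p))).2 : EM) = 0
    rw [hp, hψ0]; rfl

end Tube

theorem finrank_range_comp_comp_le {E₁ E₂ E₃ E₄ : Type*} [AddCommGroup E₁] [Module ℝ E₁]
    [AddCommGroup E₂] [Module ℝ E₂] [AddCommGroup E₃] [Module ℝ E₃] [FiniteDimensional ℝ E₃]
    [AddCommGroup E₄] [Module ℝ E₄] [FiniteDimensional ℝ E₄]
    (f : E₁ →ₗ[ℝ] E₂) (g : E₂ →ₗ[ℝ] E₃) (h : E₃ →ₗ[ℝ] E₄) :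
    Module.finrank ℝ (h.comp (g.comp f)).range ≤ Module.finrank ℝ g.range := by
  rw [LinearMap.range_comp]
  exact (Submodule.finrank_map_le _ _).trans
    (Submodule.finrank_mono (LinearMap.range_comp_le_range f g))

/-! ### Velocities and products in the chart at the identity -/

section Lie

variable {EA : Type*} [NormedAddCommGroup EA] [NormedSpace ℝ EA]
  {A : Type*} [TopologicalSpace A] [ChartedSpace EA A] [Group A]

/-- Both sides use the preferred chart at `γ 0 = 1`. This translates the velocities in
`tangentAtOne` into ordinary derivatives. -/
theorem mfderiv_curve_eq {γ : ℝ → A} (hγ : ContMDiff 𝓘(ℝ, ℝ) 𝓘(ℝ, EA) ∞ γ) (h1 : γ 0 = 1) :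
    (mfderiv 𝓘(ℝ, ℝ) 𝓘(ℝ, EA) γ 0 (1 : ℝ) : EA) = fderiv ℝ (fun t ↦ co EA 1 (γ t)) 0 1 := by
  have hd : MDifferentiableAt 𝓘(ℝ, ℝ) 𝓘(ℝ, EA) γ 0 := (hγ 0).mdifferentiableAt (by simp)
  have h2 : (fun t ↦ co EA 1 (γ t)) = fun t ↦ extChartAt 𝓘(ℝ, EA) (γ 0) (γ t) -
      extChartAt 𝓘(ℝ, EA) (1 : A) 1 := by
    funext t; rw [h1]; rfl
  rw [h2, fderiv_sub_const]
  rw [hd.mfderiv]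
  simp only [writtenInExtChartAt, extChartAt_model_space_eq_id,
    PartialEquiv.refl_symm, PartialEquiv.refl_coe, modelWithCornersSelf_coe, range_id,
    fderivWithin_univ, id_eq, Function.comp_def]
  rfl

variable [LieGroup 𝓘(ℝ, EA) ∞ A]

theorem smoothNear_co_mul :
    SmoothNear (EA × EA) EA (fun z : EA × EA ↦ co EA 1 (par EA (1 : A) z.1 * par EA (1 : A) z.2))
      (0, 0) := by
  have h1 : SmoothNear (EA × EA) EA (fun z : EA × EA ↦ par EA (1 : A) z.1) (0, 0) :=
    (smoothNear_par_zero (1 : A)).comp_of_eq (smoothNear_of_contDiff contDiff_fst _) rfl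
  have h2 : SmoothNear (EA × EA) EA (fun z : EA × EA ↦ par EA (1 : A) z.2) (0, 0) :=
    (smoothNear_par_zero (1 : A)).comp_of_eq (smoothNear_of_contDiff contDiff_snd _) rfl
  exact (smoothNear_co (mem_src_self (1 : A))).comp_of_eq (h1.mul h2) (by simp)

theorem fderiv_co_mul_inr (v : EA) :
    fderiv ℝ (fun z : EA × EA ↦ co EA 1 (par EA (1 : A) z.1 * par EA (1 : A) z.2)) (0, 0) (0, v)
      = v := by
  have hi : SmoothNear EA (EA × EA) (fun f : EA ↦ ((0 : EA), f)) 0 :=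
    smoothNear_of_contDiff (by fun_prop) _
  have h1 := fderiv_eq_comp_of_eventuallyEq (f := fun f : EA ↦ f) (x := 0) (h := fun f ↦ (0, f))
    (g := fun z : EA × EA ↦ co EA 1 (par EA (1 : A) z.1 * par EA (1 : A) z.2))
    ((eventually_co_par (1 : A)).mono fun f hf ↦ by simp [hf.1]) rfl smoothNear_co_mul hi
  have h2 : fderiv ℝ (fun f : EA ↦ ((0 : EA), f)) 0 v = (0, v) := by
    have : HasFDerivAt (fun f : EA ↦ ((0 : EA), f))
        ((0 : EA →L[ℝ] EA).prod (ContinuousLinearMap.id ℝ EA)) 0 :=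
      (hasFDerivAt_const _ _).prodMk (hasFDerivAt_id _)
    rw [this.fderiv]; rfl
  have h3 := congrArg (fun T ↦ T v) h1
  simp only [ContinuousLinearMap.comp_apply, h2] at h3
  rw [← h3]; simp

end Lie

/-! ### Orbit maps and a local retraction onto the isotropy group -/

section Orbit

variable {EA EM : Type*} [NormedAddCommGroup EA] [NormedSpace ℝ EA]
  [NormedAddCommGroup EM] [NormedSpace ℝ EM]
  {A : Type*} [TopologicalSpace A] [ChartedSpace EA A] [Group A]
  {M : Type*} [TopologicalSpace M] [ChartedSpace EM M] [MulAction A M]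
  [LieGroup 𝓘(ℝ, EA) ∞ A] [IsManifold 𝓘(ℝ, EM) ∞ M] [ContMDiffSMul 𝓘(ℝ, EA) 𝓘(ℝ, EM) ∞ A M]

omit [IsManifold 𝓘(ℝ, EM) ∞ M] in
theorem smoothNear_orbit (x : M) : SmoothNear EA EM (fun p : EA ↦ par EA (1 : A) p • x) 0 :=
  (smoothNear_par_zero (1 : A)).smul (smoothNear_const x 0)

theorem eventually_nhds_one_iff {P : A → Prop} :
    (∀ᶠ k in 𝓝 (1 : A), P k) ↔ ∀ᶠ p in 𝓝 (0 : EA), P (par EA (1 : A) p) := by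
  constructor
  · intro h
    exact (smoothNear_par_zero (E := EA) (1 : A)).continuousAt.eventually (by simpa using h)
  · intro h
    have h1 : ∀ᶠ k in 𝓝 (1 : A), P (par EA (1 : A) (co EA 1 k)) :=
      (smoothNear_co (mem_src_self (E := EA) (1 : A))).continuousAt.eventually (by simpa using h)
    filter_upwards [h1, src_mem_nhds (E := EA) (1 : A)] with k hk hk2
    rwa [par_co hk2] at hk

variable [FiniteDimensional ℝ EM]

/-- The orbit map satisfies the tangency condition of `exists_tube`. -/
theorem eventually_orbit_tangent (x : M) : ∀ᶠ p in 𝓝 (0 : EA),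
    (fderiv ℝ (fun q : EA ↦ co EM x (par EA (1 : A) q • x)) p).range ≤
      (orbD EA EM A x (par EA (1 : A) p • x)).range ∧
    Module.finrank ℝ (orbD EA EM A x (par EA (1 : A) p • x)).range ≤
      Module.finrank ℝ (orbD EA EM A x x).range := by
  have hsrc : ∀ᶠ p in 𝓝 (0 : EA), par EA (1 : A) p • x ∈ src EM x :=
    (smoothNear_orbit (EA := EA) (EM := EM) (A := A) x).continuousAt (by simpa using src_mem_nhds (E := EM) x)
  filter_upwards [hsrc, (smoothNear_par_zero (E := EA) (1 : A)).eventually] with p hp hpar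
  set k := par EA (1 : A) p with hk
  constructor
  · have hθ : SmoothNear EA EA (fun q : EA ↦ par EA (1 : A) q * k⁻¹) p :=
      hpar.mul (smoothNear_const _ _)
    have h1 := fderiv_co_smul hp hθ (by simp [hk])
    have h2 : (fun q : EA ↦ co EM x ((par EA (1 : A) q * k⁻¹) • k • x)) =
        fun q : EA ↦ co EM x (par EA (1 : A) q • x) := by
      funext q; rw [smul_smul, inv_mul_cancel_right]
    rw [h2] at h1
    rw [h1]
    exact LinearMap.range_comp_le_range _ _
  -- From `q • k • x = k • (k⁻¹ * q * k) • x`, the derivative of the orbit map at `k • x` factors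
  -- through the one at `x`, so its rank is no larger.
  · have hθ : SmoothNear EA EA (fun q : EA ↦ k⁻¹ * par EA (1 : A) q * k) 0 :=
      ((smoothNear_const _ _).mul (smoothNear_par_zero _)).mul (smoothNear_const _ _)
    have hθ1 : k⁻¹ * par EA (1 : A) 0 * k = 1 := by simp
    have h1 := fderiv_co_smul (mem_src_self (E := EM) x) hθ hθ1
    have hin : SmoothNear EA EM (fun q : EA ↦ (k⁻¹ * par EA (1 : A) q * k) • x) 0 :=
      hθ.smul (smoothNear_const x 0)
    have hG : SmoothNear EM EM (fun e : EM ↦ co EM x (k • par EM x e)) 0 :=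
      (smoothNear_co hp).comp_of_eq
        ((smoothNear_const_smul EA k _).comp_of_eq (smoothNear_par_zero x) rfl) (by simp)
    have h2 := fderiv_eq_comp_of_eventuallyEq
      (f := fun q : EA ↦ co EM x (par EA (1 : A) q • k • x))
      (g := fun e : EM ↦ co EM x (k • par EM x e))
      (h := fun q : EA ↦ co EM x ((k⁻¹ * par EA (1 : A) q * k) • x)) (x := 0) (y := 0) ?_
      (by simp) hG ((smoothNear_co (mem_src_self x)).comp_of_eq hin (by simp))
    · rw [orbD, h2, h1]
      exact finrank_range_comp_comp_le _ _ _
    · have h3 : ∀ᶠ q in 𝓝 (0 : EA), (k⁻¹ * par EA (1 : A) q * k) • x ∈ src EM x :=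
        hin.continuousAt (by simpa using src_mem_nhds (E := EM) x)
      filter_upwards [h3] with q hq
      rw [par_co hq, smul_smul, smul_smul]
      congr 2; group

/-- A smooth local retraction of `A` onto the isotropy group of `x`. -/
theorem exists_stabilizer_retraction (EA : Type*) [NormedAddCommGroup EA] [NormedSpace ℝ EA]
    (EM : Type*) [NormedAddCommGroup EM] [NormedSpace ℝ EM]
    (A : Type*) [TopologicalSpace A] [ChartedSpace EA A] [Group A]
    {M : Type*} [TopologicalSpace M] [ChartedSpace EM M] [MulAction A M]
    [LieGroup 𝓘(ℝ, EA) ∞ A] [IsManifold 𝓘(ℝ, EM) ∞ M] [ContMDiffSMul 𝓘(ℝ, EA) 𝓘(ℝ, EM) ∞ A M]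
    [FiniteDimensional ℝ EA] [FiniteDimensional ℝ EM] (x : M) :
    ∃ τ : A → A, SmoothNear EA EA τ 1 ∧ τ 1 = 1 ∧
      (∀ᶠ k in 𝓝 1, τ k ∈ MulAction.stabilizer A x) ∧
      (∀ k ∈ MulAction.stabilizer A x, τ k = k) ∧
      ∀ v, orbD EA EM A x x v = 0 →
        fderiv ℝ (fun a ↦ co EA 1 (τ (par EA (1 : A) a))) 0 v = v := by
  obtain ⟨N, hN⟩ := Submodule.exists_isCompl (orbD EA EM A x x).range
  have hid : HasFDerivAt (fun n ↦ co EM x (par EM x n)) (ContinuousLinearMap.id ℝ EM) 0 :=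
    (hasFDerivAt_id 0).congr_of_eventuallyEq ((eventually_co_par x).mono fun v hv ↦ hv.1)
  obtain ⟨c, s, hc, hc1, -, -, -, hcs, -, hβ⟩ :=
    exists_tube (A := A) (EA := EA) x (smoothNear_par_zero x) (par_zero EM x) hid hN
  have hs0 := hβ (fun p ↦ par EA (1 : A) p • x) (smoothNear_orbit x) (by simp)
    (eventually_orbit_tangent x)
  have hsm : SmoothNear EA EM (fun k : A ↦ k • x) 1 := (smoothNear_id 1).smul (smoothNear_const x 1)
  have horb : Tendsto (fun k : A ↦ k • x) (𝓝 1) (𝓝 x) := by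
    simpa [ContinuousAt] using hsm.continuousAt
  have hck : SmoothNear EA EA (fun k : A ↦ c (k • x)) 1 := hc.comp_of_eq hsm (by simp)
  have hτ : SmoothNear EA EA (fun k : A ↦ (c (k • x))⁻¹ * k) 1 := hck.inv.mul (smoothNear_id 1)
  -- Since `s (k • x) = 0` for `k` near `1`, the tube gives `c (k • x) • x = k • x`; dividing `k` by
  -- `c (k • x)` therefore lands in the isotropy group.
  refine ⟨fun k ↦ (c (k • x))⁻¹ * k, hτ, by simp [hc1], ?_, ?_, ?_⟩
  · filter_upwards [horb.eventually hcs, (eventually_nhds_one_iff (EA := EA) (P := fun k ↦ s (k • x) = 0)).2 hs0] with k h1 h2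
    rw [h2, par_zero] at h1
    rw [MulAction.mem_stabilizer_iff, mul_smul, inv_smul_eq_iff, h1]
  · intro k hk
    simp [MulAction.mem_stabilizer_iff.1 hk, hc1]
  · intro v hv
    have hu : SmoothNear EA EA (fun a : EA ↦ co EA 1 (c (par EA (1 : A) a • x))) 0 :=
      (smoothNear_co (mem_src_self (1 : A))).comp_of_eq
        (hc.comp_of_eq (smoothNear_orbit x) (by simp)) (by simp [hc1])
    have hτp : SmoothNear EA EA (fun a : EA ↦ (c (par EA (1 : A) a • x))⁻¹ * par EA (1 : A) a) 0 :=
      hτ.comp_of_eq (smoothNear_par_zero (1 : A)) (by simp)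
    have ht : SmoothNear EA EA
        (fun a : EA ↦ co EA 1 ((c (par EA (1 : A) a • x))⁻¹ * par EA (1 : A) a)) 0 :=
      (smoothNear_co (mem_src_self (1 : A))).comp_of_eq hτp (by simp [hc1])
    have hu0 : fderiv ℝ (fun a : EA ↦ co EA 1 (c (par EA (1 : A) a • x))) 0 v = 0 := by
      have hin : SmoothNear EM EA (fun e ↦ co EA 1 (c (par EM x e))) 0 :=
        (smoothNear_co (mem_src_self (1 : A))).comp_of_eq
          (hc.comp_of_eq (smoothNear_par_zero x) (by simp)) (by simp [hc1])
      have h1 := fderiv_eq_comp_of_eventuallyEq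
        (f := fun a : EA ↦ co EA 1 (c (par EA (1 : A) a • x)))
        (g := fun e ↦ co EA 1 (c (par EM x e))) (h := fun a : EA ↦ co EM x (par EA (1 : A) a • x))
        (x := 0) (y := 0) ?_ (by simp) hin (smoothNear_orbit_chart (mem_src_self x))
      · have hv' : fderiv ℝ (fun a : EA ↦ co EM x (par EA (1 : A) a • x)) 0 v = 0 := hv
        rw [h1, ContinuousLinearMap.comp_apply, hv', map_zero]
      · have : ∀ᶠ a in 𝓝 (0 : EA), par EA (1 : A) a • x ∈ src EM x :=
          (smoothNear_orbit (EA := EA) (EM := EM) (A := A) x).continuousAt (by simpa using src_mem_nhds (E := EM) x)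
        filter_upwards [this] with a ha
        rw [par_co ha]
    -- Differentiate `c (a • x) * τ a = a` in the direction `v`: the first factor contributes
    -- nothing, because `v` does not move `x` to first order.
    have hprod := fderiv_eq_comp_of_eventuallyEq (f := fun a : EA ↦ a)
      (g := fun z : EA × EA ↦ co EA 1 (par EA (1 : A) z.1 * par EA (1 : A) z.2))
      (h := fun a : EA ↦ (co EA 1 (c (par EA (1 : A) a • x)),
        co EA 1 ((c (par EA (1 : A) a • x))⁻¹ * par EA (1 : A) a))) (x := 0) (y := (0, 0)) ?_
      (by simp [hc1]) smoothNear_co_mul (hu.prodMk ht)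
    · rw [DifferentiableAt.fderiv_prodMk hu.differentiableAt ht.differentiableAt] at hprod
      have h3 := congrArg (fun T ↦ T v) hprod
      simp only [ContinuousLinearMap.comp_apply, ContinuousLinearMap.prod_apply, hu0,
        fderiv_co_mul_inr] at h3
      rw [← h3]; simp
    · have h1 : ∀ᶠ a in 𝓝 (0 : EA), c (par EA (1 : A) a • x) ∈ src EA (1 : A) :=
        (hc.comp_of_eq (smoothNear_orbit x) (by simp)).continuousAt
          (by simpa [hc1] using src_mem_nhds (E := EA) (1 : A))
      have h2 : ∀ᶠ a in 𝓝 (0 : EA), (c (par EA (1 : A) a • x))⁻¹ * par EA (1 : A) a ∈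
          src EA (1 : A) :=
        hτp.continuousAt (by simpa [hc1] using src_mem_nhds (E := EA) (1 : A))
      filter_upwards [h1, h2, eventually_co_par (1 : A)] with a ha hb hd
      rw [par_co ha, par_co hb, mul_inv_cancel_left, hd.1]

end Orbit

/-! ### The Lie algebra of an isotropy group -/

section Isotropy

variable {EA EM : Type*} [NormedAddCommGroup EA] [NormedSpace ℝ EA]
  [NormedAddCommGroup EM] [NormedSpace ℝ EM]
  {A : Type*} [TopologicalSpace A] [ChartedSpace EA A] [Group A]
  {M : Type*} [TopologicalSpace M] [ChartedSpace EM M] [MulAction A M]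

instance instFiniteDimensionalGroupLieAlgebra [FiniteDimensional ℝ EA] :
    FiniteDimensional ℝ (GroupLieAlgebra 𝓘(ℝ, EA) A) :=
  inferInstanceAs (FiniteDimensional ℝ EA)

theorem tangentAtOne_mono {S T : Subgroup A} (h : S ≤ T) :
    tangentAtOne EA S ≤ tangentAtOne EA T :=
  Submodule.span_mono fun _ ⟨γ, h1, h2, h3⟩ ↦ ⟨γ, h1, fun t ↦ h (h2 t), h3⟩

theorem subgroupDim_mono [FiniteDimensional ℝ EA] {S T : Subgroup A} (h : S ≤ T) :
    subgroupDim EA S ≤ subgroupDim EA T :=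
  Submodule.finrank_mono (tangentAtOne_mono h)

variable [LieGroup 𝓘(ℝ, EA) ∞ A] [IsManifold 𝓘(ℝ, EM) ∞ M]
  [ContMDiffSMul 𝓘(ℝ, EA) 𝓘(ℝ, EM) ∞ A M]

/-- A curve in the isotropy group leaves `s` fixed, so the derivative of the orbit map kills its
velocity. With the converse below, at `s = x`, the tangent space of the isotropy group is the kernel
of `orbD`. -/
theorem orbD_eq_zero_of_mem_tangentAtOne {x s : M} (hs : s ∈ src EM x)
    {v : GroupLieAlgebra 𝓘(ℝ, EA) A} (hv : v ∈ tangentAtOne EA (MulAction.stabilizer A s)) :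
    orbD EA EM A x s v = 0 := by
  have hle : tangentAtOne EA (MulAction.stabilizer A s) ≤
      ((orbD EA EM A x s).ker : Submodule ℝ EA) := by
    refine Submodule.span_le.2 ?_
    rintro _ ⟨γ, hγ, hS, h1, rfl⟩
    have hγs : SmoothNear ℝ EA γ 0 := smoothNear_of_contMDiff hγ 0
    have h2 := fderiv_co_smul hs hγs h1
    have h3 : (fun t ↦ co EM x (γ t • s)) = fun _ ↦ co EM x s := by
      funext t; rw [MulAction.mem_stabilizer_iff.1 (hS t)]
    rw [h3, fderiv_fun_const] at h2
    have h4 := congrArg (fun T ↦ T 1) h2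
    simp only [ContinuousLinearMap.comp_apply, ← mfderiv_curve_eq hγ h1] at h4
    exact h4.symm
  exact hle hv

variable [FiniteDimensional ℝ EA] [FiniteDimensional ℝ EM]

/-- The retraction `τ` pushes a curve with velocity along `v` into the isotropy group without
changing its velocity. -/
theorem mem_tangentAtOne_of_orbD_eq_zero {x : M} {v : EA} (hv : orbD EA EM A x x v = 0) :
    (v : GroupLieAlgebra 𝓘(ℝ, EA) A) ∈ tangentAtOne EA (MulAction.stabilizer A x) := by
  obtain ⟨τ, hτ, hτ1, hτx, -, hτv⟩ := exists_stabilizer_retraction EA EM A x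
  have hτp : SmoothNear EA EA (fun a ↦ τ (par EA (1 : A) a)) 0 :=
    hτ.comp_of_eq (smoothNear_par_zero 1) (by simp)
  have h0 := hτp.and ((eventually_nhds_one_iff (EA := EA)).1 hτx)
  obtain ⟨r, hr, hball⟩ := Metric.eventually_nhds_iff_ball.1 h0
  -- Curves in `tangentAtOne` must be smooth on all of `ℝ`, whereas `τ` is controlled only on a
  -- ball. The curve `(ε * sin t) • v` never leaves that ball and has velocity `ε • v` at `0`; the
  -- factor `ε` is removed by scaling.
  set ε : ℝ := r / (‖v‖ + 1) with hε
  have hεpos : 0 < ε := by positivity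
  have hmem : ∀ t : ℝ, (ε * Real.sin t) • v ∈ Metric.ball (0 : EA) r := by
    intro t
    rw [mem_ball_zero_iff, norm_smul, norm_mul, Real.norm_eq_abs, Real.norm_eq_abs,
      abs_of_pos hεpos]
    have h1 : |Real.sin t| ≤ 1 := Real.abs_sin_le_one t
    calc ε * |Real.sin t| * ‖v‖ ≤ ε * 1 * ‖v‖ := by gcongr
      _ < ε * (‖v‖ + 1) := by nlinarith
      _ = r := by rw [hε]; field_simp
  have hc : ContDiff ℝ ∞ fun t : ℝ ↦ (ε * Real.sin t) • v :=
    (contDiff_const.mul Real.contDiff_sin).smul contDiff_const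
  have hγ : ContMDiff 𝓘(ℝ, ℝ) 𝓘(ℝ, EA) ∞
      fun t : ℝ ↦ τ (par EA (1 : A) ((ε * Real.sin t) • v)) := fun t ↦
    ContMDiffAt.comp (g := fun a : EA ↦ τ (par EA (1 : A) a)) t (hball _ (hmem t)).1 hc.contMDiff.contMDiffAt
  have hγ1 : τ (par EA (1 : A) ((ε * Real.sin 0) • v)) = 1 := by simp [hτ1]
  have hvel : fderiv ℝ (fun t : ℝ ↦ co EA 1 (τ (par EA (1 : A) ((ε * Real.sin t) • v)))) 0 1
      = ε • v := by
    have hco : SmoothNear EA EA (fun a ↦ co EA 1 (τ (par EA (1 : A) a))) 0 :=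
      (smoothNear_co (mem_src_self 1)).comp_of_eq hτp (by simp [hτ1])
    have h1 := fderiv_eq_comp_of_eventuallyEq
      (f := fun t : ℝ ↦ co EA 1 (τ (par EA (1 : A) ((ε * Real.sin t) • v))))
      (g := fun a ↦ co EA 1 (τ (par EA (1 : A) a))) (x := 0) (y := 0)
      EventuallyEq.rfl (by simp) hco (smoothNear_of_contDiff hc 0)
    have h2 : HasDerivAt (fun t : ℝ ↦ (ε * Real.sin t) • v) ((ε * Real.cos 0) • v) 0 :=
      ((Real.hasDerivAt_sin 0).const_mul ε).smul_const v
    rw [h1, ContinuousLinearMap.comp_apply]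
    have h3 : fderiv ℝ (fun t : ℝ ↦ (ε * Real.sin t) • v) 0 1 = ε • v := by
      rw [h2.hasFDerivAt.fderiv]; simp
    rw [h3, map_smul, hτv v hv]
  have hin : (ε • v : GroupLieAlgebra 𝓘(ℝ, EA) A) ∈
      tangentAtOne EA (MulAction.stabilizer A x) := by
    refine Submodule.subset_span ⟨_, hγ, fun t ↦ (hball _ (hmem t)).2, hγ1, ?_⟩
    exact hvel.symm.trans (mfderiv_curve_eq hγ hγ1).symm
  have := (tangentAtOne EA (MulAction.stabilizer A x)).smul_mem ε⁻¹ hin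
  have hv1 : ε⁻¹ • ε • v = v := inv_smul_smul₀ hεpos.ne' v
  exact hv1 ▸ this

/-- Nested isotropy groups of equal dimension agree near the identity. -/
theorem eventually_mem_stabilizer {x s : M} (hs : s ∈ src EM x)
    (hle : MulAction.stabilizer A s ≤ MulAction.stabilizer A x)
    (hdim : subgroupDim EA (MulAction.stabilizer A x) ≤
      subgroupDim EA (MulAction.stabilizer A s)) :
    ∀ᶠ t in 𝓝 (1 : A), t ∈ MulAction.stabilizer A x → t ∈ MulAction.stabilizer A s := by
  have htan : tangentAtOne EA (MulAction.stabilizer A s) =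
      tangentAtOne EA (MulAction.stabilizer A x) :=
    Submodule.eq_of_le_of_finrank_le (tangentAtOne_mono hle) hdim
  have hker : ∀ v : EA, orbD EA EM A x x v = 0 → orbD EA EM A x s v = 0 := fun v hv ↦
    orbD_eq_zero_of_mem_tangentAtOne hs
      (htan ▸ mem_tangentAtOne_of_orbD_eq_zero (EA := EA) (EM := EM) (A := A) hv)
  obtain ⟨τ, hτ, hτ1, hτx, hτS, -⟩ := exists_stabilizer_retraction EA EM A x
  have hτp : SmoothNear EA EA (fun a ↦ τ (par EA (1 : A) a)) 0 :=
    hτ.comp_of_eq (smoothNear_par_zero 1) (by simp)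
  have hτs : SmoothNear EA EM (fun a : EA ↦ τ (par EA (1 : A) a) • s) 0 :=
    hτp.smul (smoothNear_const s 0)
  have hsrc : ∀ᶠ a in 𝓝 (0 : EA), τ (par EA (1 : A) a) • s ∈ src EM x :=
    hτs.continuousAt (by simpa [hτ1] using (isOpen_src x).mem_nhds hs)
  have hτxp := (eventually_nhds_one_iff (EA := EA)).1 hτx
  -- Translated by `k⁻¹`, the map `τ` passes through `1` inside the isotropy group of `x`. Its
  -- derivative is killed by the orbit map of `x`, hence by that of `s` through `hker`, so `τ` moves
  -- `s` with zero derivative. Thus `τ` fixes `s` near `1`, and `τ` is the identity on the isotropy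
  -- group of `x`.
  have hder : ∀ᶠ u in 𝓝 (0 : EA), HasFDerivAt
      (fun a : EA ↦ co EM x (τ (par EA (1 : A) a) • s)) (0 : EA →L[ℝ] EM) u := by
    filter_upwards [hτxp.eventually_nhds, hτp.eventually, hsrc] with u h1 h2 h3
    set k := τ (par EA (1 : A) u) with hk
    have hkx : k • x = x := h1.self_of_nhds
    have hθ : SmoothNear EA EA (fun a : EA ↦ k⁻¹ * τ (par EA (1 : A) a)) u :=
      (smoothNear_const _ _).mul h2
    have hθ1 : k⁻¹ * τ (par EA (1 : A) u) = 1 := by simp [hk]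
    set T := fderiv ℝ (fun a : EA ↦ co EA 1 (k⁻¹ * τ (par EA (1 : A) a))) u with hT
    have hx := fderiv_co_smul (mem_src_self (E := EM) x) hθ hθ1
    have hx0 : (fun a : EA ↦ co EM x ((k⁻¹ * τ (par EA (1 : A) a)) • x)) =ᶠ[𝓝 u]
        fun _ ↦ (0 : EM) := by
      filter_upwards [h1] with a ha
      rw [mul_smul, MulAction.mem_stabilizer_iff.1 ha, inv_smul_eq_iff.2 hkx.symm, co_self]
    rw [hx0.fderiv_eq, fderiv_fun_const] at hx
    have hsθ : fderiv ℝ (fun a : EA ↦ co EM x ((k⁻¹ * τ (par EA (1 : A) a)) • s)) u = 0 := by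
      rw [fderiv_co_smul hs hθ hθ1]
      ext v
      exact hker _ (congrArg (fun T ↦ T v) hx).symm
    have hin : SmoothNear EA EM (fun a : EA ↦ (k⁻¹ * τ (par EA (1 : A) a)) • s) u :=
      hθ.smul (smoothNear_const s u)
    have hG : SmoothNear EM EM (fun e : EM ↦ co EM x (k • par EM x e)) (co EM x s) :=
      (smoothNear_co h3).comp_of_eq
        ((smoothNear_const_smul EA k _).comp_of_eq (smoothNear_par hs) rfl) (by rw [par_co hs])
    have hfin := fderiv_eq_comp_of_eventuallyEq
      (f := fun a : EA ↦ co EM x (τ (par EA (1 : A) a) • s))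
      (g := fun e : EM ↦ co EM x (k • par EM x e))
      (h := fun a : EA ↦ co EM x ((k⁻¹ * τ (par EA (1 : A) a)) • s)) (x := u) (y := co EM x s) ?_
      (by simp [hk]) hG ((smoothNear_co hs).comp_of_eq hin (by simp [hk]))
    · rw [hsθ, ContinuousLinearMap.comp_zero] at hfin
      rw [← hfin]
      exact ((smoothNear_co h3).comp_of_eq (h2.smul (smoothNear_const s u))
        rfl).differentiableAt.hasFDerivAt
    · have : ∀ᶠ a in 𝓝 u, (k⁻¹ * τ (par EA (1 : A) a)) • s ∈ src EM x :=
        hin.continuousAt ((isOpen_src x).mem_nhds (by simpa [hk] using hs))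
      filter_upwards [this] with a ha
      rw [par_co ha, smul_smul, mul_inv_cancel_left]
  have hconst := eventually_eq_of_fderiv_eq_zero hder
  refine (eventually_nhds_one_iff (EA := EA)).2 ?_
  filter_upwards [hconst, hsrc] with a ha hasrc hax
  rw [hτS _ hax] at ha hasrc
  simp only [par_zero, hτ1, one_smul] at ha
  exact co_injOn hasrc hs ha

end Isotropy

/-! ### The adjoint representation in a chart -/

section Adjoint

variable {EK : Type*} [NormedAddCommGroup EK] [NormedSpace ℝ EK]
  {K : Type*} [TopologicalSpace K] [ChartedSpace EK K] [Group K]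

variable (EK) in
/-- The adjoint representation in the chart centered at the identity. -/
noncomputable def adj (k : K) : EK →L[ℝ] EK :=
  fderiv ℝ (fun e : EK ↦ co EK 1 (k * par EK (1 : K) e * k⁻¹)) 0

variable [LieGroup 𝓘(ℝ, EK) ∞ K]

theorem smoothNear_conj (k l : K) : SmoothNear EK EK (fun m : K ↦ k * m * k⁻¹) l :=
  ((smoothNear_const _ _).mul (smoothNear_id _)).mul (smoothNear_const _ _)

/-- Derivative of a conjugated curve. -/
theorem fderiv_co_conj {P : Type*} [NormedAddCommGroup P] [NormedSpace ℝ P] {θ : P → K} {p : P}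
    (hθ : SmoothNear P EK θ p) (h1 : θ p = 1) (k : K) :
    fderiv ℝ (fun q ↦ co EK 1 (k * θ q * k⁻¹)) p =
      (adj EK k).comp (fderiv ℝ (fun q ↦ co EK 1 (θ q)) p) := by
  have hco : SmoothNear P EK (fun q ↦ co EK 1 (θ q)) p :=
    (smoothNear_co (mem_src_self (1 : K))).comp_of_eq hθ h1
  have hin : SmoothNear EK EK (fun e : EK ↦ co EK 1 (k * par EK (1 : K) e * k⁻¹)) 0 :=
    (smoothNear_co (mem_src_self (1 : K))).comp_of_eq
      ((smoothNear_conj k _).comp_of_eq (smoothNear_par_zero (1 : K)) rfl) (by simp)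
  refine fderiv_eq_comp_of_eventuallyEq
    (g := fun e : EK ↦ co EK 1 (k * par EK (1 : K) e * k⁻¹)) ?_ (by simp [h1]) hin hco
  have : ∀ᶠ q in 𝓝 p, θ q ∈ src EK (1 : K) :=
    hθ.continuousAt (by rw [h1]; exact src_mem_nhds 1)
  filter_upwards [this] with q hq
  simp only [par_co hq]

theorem continuous_adj : Continuous (adj EK : K → EK →L[ℝ] EK) := by
  rw [continuous_iff_continuousAt]
  intro k₀
  have h1 : SmoothNear (EK × EK) EK (fun z : EK × EK ↦ par EK (1 : K) z.1) (0, 0) :=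
    (smoothNear_par_zero (1 : K)).comp_of_eq (smoothNear_of_contDiff contDiff_fst _) rfl
  have h2 : SmoothNear (EK × EK) EK (fun z : EK × EK ↦ par EK (1 : K) z.2) (0, 0) :=
    (smoothNear_par_zero (1 : K)).comp_of_eq (smoothNear_of_contDiff contDiff_snd _) rfl
  have h3 : SmoothNear (EK × EK) EK (fun z : EK × EK ↦ k₀ * par EK (1 : K) z.1) (0, 0) :=
    (smoothNear_const _ _).mul h1
  have hg : SmoothNear (EK × EK) EK (fun z : EK × EK ↦ co EK 1
      (k₀ * par EK (1 : K) z.1 * par EK (1 : K) z.2 * (k₀ * par EK (1 : K) z.1)⁻¹)) (0, 0) :=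
    (smoothNear_co (mem_src_self (1 : K))).comp_of_eq ((h3.mul h2).mul h3.inv) (by simp)
  have hd := (eventually_contDiffAt_partial_fderiv (smoothNear_vec_iff.1 hg)).self_of_nhds
  have hq : SmoothNear EK EK (fun k : K ↦ co EK 1 (k₀⁻¹ * k)) k₀ :=
    (smoothNear_co (mem_src_self (1 : K))).comp_of_eq
      ((smoothNear_const _ _).mul (smoothNear_id _)) (by simp)
  have hc : ContinuousAt (fun k : K ↦ (co EK 1 (k₀⁻¹ * k), (0 : EK))) k₀ :=
    hq.continuousAt.prodMk continuousAt_const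
  have := ContinuousAt.comp_of_eq hd.continuousAt hc (by simp)
  refine this.congr ?_
  have hs : ∀ᶠ k in 𝓝 k₀, k₀⁻¹ * k ∈ src EK (1 : K) :=
    (((smoothNear_const (E := EK) (F := EK) (k₀⁻¹ : K) k₀).mul
      (smoothNear_id k₀)).continuousAt) (by simpa using src_mem_nhds (E := EK) (1 : K))
  filter_upwards [hs] with k hk
  simp only [Function.comp_def, par_co hk, mul_inv_cancel_left, adj]

end Adjoint

/-! ### Local normality of a dense Lie subgroup -/

section Normal

variable {EG EK : Type*} [NormedAddCommGroup EG] [NormedSpace ℝ EG] [FiniteDimensional ℝ EG]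
  [NormedAddCommGroup EK] [NormedSpace ℝ EK] [FiniteDimensional ℝ EK]
  {G : Type*} [TopologicalSpace G] [ChartedSpace EG G] [Group G] [LieGroup 𝓘(ℝ, EG) ∞ G]
  {K : Type*} [TopologicalSpace K] [ChartedSpace EK K] [Group K] [LieGroup 𝓘(ℝ, EK) ∞ K]
  (ι : G →* K) (hι : ContMDiff 𝓘(ℝ, EG) 𝓘(ℝ, EK) ∞ ι)

include hι

omit [FiniteDimensional ℝ EG] [FiniteDimensional ℝ EK] in
theorem fderiv_co_hom {P : Type*} [NormedAddCommGroup P] [NormedSpace ℝ P] {θ : P → G} {p : P}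
    (hθ : SmoothNear P EG θ p) (h1 : θ p = 1) :
    fderiv ℝ (fun q ↦ co EK 1 (ι (θ q))) p =
      (fderiv ℝ (fun a ↦ co EK 1 (ι (par EG (1 : G) a))) 0).comp
        (fderiv ℝ (fun q ↦ co EG 1 (θ q)) p) := by
  have hco : SmoothNear P EG (fun q ↦ co EG 1 (θ q)) p :=
    (smoothNear_co (mem_src_self (1 : G))).comp_of_eq hθ h1
  have hin : SmoothNear EG EK (fun a ↦ co EK 1 (ι (par EG (1 : G) a))) 0 :=
    (smoothNear_co (mem_src_self (1 : K))).comp_of_eq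
      ((smoothNear_of_contMDiff hι _).comp_of_eq (smoothNear_par_zero (1 : G)) rfl) (by simp)
  refine fderiv_eq_comp_of_eventuallyEq
    (g := fun a ↦ co EK 1 (ι (par EG (1 : G) a))) ?_ (by simp [h1]) hin hco
  have : ∀ᶠ q in 𝓝 p, θ q ∈ src EG (1 : G) :=
    hθ.continuousAt (by rw [h1]; exact src_mem_nhds 1)
  filter_upwards [this] with q hq
  simp only [par_co hq]

omit [FiniteDimensional ℝ EG] in
/-- The Lie algebra of a dense Lie subgroup is invariant under the adjoint action. -/
theorem adj_mem_range (hd : DenseRange ι) (k : K) (v : EG) :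
    adj EK k (fderiv ℝ (fun a ↦ co EK 1 (ι (par EG (1 : G) a))) 0 v) ∈
      (fderiv ℝ (fun a ↦ co EK 1 (ι (par EG (1 : G) a))) 0).range := by
  set J := fderiv ℝ (fun a ↦ co EK 1 (ι (par EG (1 : G) a))) 0 with hJ
  -- The range of `J` is closed, being finite-dimensional, so by density only `k = ι g` remains.
  -- There `ι (g * a * g⁻¹) = ι g * ι a * (ι g)⁻¹` differentiates to the claim.
  have hcl : IsClosed {k : K | adj EK k (J v) ∈ J.range} :=
    (Submodule.closed_of_finiteDimensional _).preimage
      ((ContinuousLinearMap.apply ℝ EK (J v)).continuous.comp continuous_adj)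
  refine hd.induction_on (p := fun k ↦ adj EK k (J v) ∈ J.range) k hcl fun g ↦ ?_
  have hpar := smoothNear_par_zero (E := EG) (1 : G)
  have h1 := fderiv_co_conj (θ := fun a : EG ↦ ι (par EG (1 : G) a)) (p := 0)
    ((smoothNear_of_contMDiff hι _).comp_of_eq hpar rfl) (by simp) (ι g)
  have h2 := fderiv_co_hom ι hι (θ := fun a : EG ↦ g * par EG (1 : G) a * g⁻¹) (p := 0)
    ((smoothNear_conj g _).comp_of_eq hpar rfl) (by simp)
  simp only [map_mul, map_inv] at h2
  rw [h1] at h2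
  exact ⟨_, (congrArg (fun T ↦ T v) h2).symm⟩

/-- A dense Lie subgroup is normal, near the identity, with smooth conjugation. -/
theorem exists_conj_lift (hd : DenseRange ι) (k : K) :
    ∃ c : K → G, SmoothNear EK EG c 1 ∧ c 1 = 1 ∧
      ∀ᶠ g in 𝓝 (1 : G), ι (c (k * ι g * k⁻¹)) = k * ι g * k⁻¹ := by
  -- Let `G` act on `K` by left translation. The orbit of `1` is the image of `ι`, so the tube at
  -- `1` recognizes locally when a map stays in this image.
  let _ : MulAction G K := MulAction.compHom K ι
  have hsmul : ∀ (g : G) (l : K), g • l = ι g * l := fun _ _ ↦ rfl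
  have : ContMDiffSMul 𝓘(ℝ, EG) 𝓘(ℝ, EK) ∞ G K :=
    ⟨(hι.comp contMDiff_fst).mul contMDiff_snd⟩
  obtain ⟨N, hN⟩ := Submodule.exists_isCompl (orbD EG EK G (1 : K) 1).range
  have hid : HasFDerivAt (fun n ↦ co EK 1 (par EK (1 : K) n)) (ContinuousLinearMap.id ℝ EK) 0 :=
    (hasFDerivAt_id 0).congr_of_eventuallyEq ((eventually_co_par 1).mono fun v hv ↦ hv.1)
  obtain ⟨c, s, hc, hc1, -, -, -, hcs, -, hβ⟩ :=
    exists_tube (A := G) (EA := EG) 1 (smoothNear_par_zero 1) (par_zero EK (1 : K)) hid hN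
  set J := fderiv ℝ (fun a ↦ co EK 1 (ι (par EG (1 : G) a))) 0 with hJ
  -- right translations in the chart
  let R : K → EK → EK := fun y e ↦ co EK 1 (par EK (1 : K) e * y)
  have hR : ∀ y ∈ src EK (1 : K), SmoothNear EK EK (R y) 0 := fun y hy ↦
    (smoothNear_co (by simpa)).comp
      ((smoothNear_par_zero (1 : K)).mul (smoothNear_const y 0))
  have hRfac : ∀ y ∈ src EK (1 : K), ∀ (θ : EG → K) (p : EG), SmoothNear EG EK θ p → θ p = 1 →
      fderiv ℝ (fun q ↦ co EK 1 (θ q * y)) p =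
        (fderiv ℝ (R y) 0).comp (fderiv ℝ (fun q ↦ co EK 1 (θ q)) p) := by
    intro y hy θ p hθ h1
    refine fderiv_eq_comp_of_eventuallyEq (g := R y) ?_ (by simp [h1]) (hR y hy)
      ((smoothNear_co (mem_src_self (1 : K))).comp_of_eq hθ h1)
    have : ∀ᶠ q in 𝓝 p, θ q ∈ src EK (1 : K) :=
      hθ.continuousAt (by rw [h1]; exact src_mem_nhds 1)
    filter_upwards [this] with q hq
    simp only [R, par_co hq]
  have hιpar : SmoothNear EG EK (fun a : EG ↦ ι (par EG (1 : G) a)) 0 :=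
    (smoothNear_of_contMDiff hι _).comp_of_eq (smoothNear_par_zero 1) rfl
  -- The orbits are the cosets `ι(G) * y`, so their tangent spaces are right translates of the range
  -- of `J`.
  have horb : ∀ y ∈ src EK (1 : K), orbD EG EK G 1 y = (fderiv ℝ (R y) 0).comp J := fun y hy ↦
    hRfac y hy (fun a : EG ↦ ι (par EG (1 : G) a)) 0 hιpar (by simp)
  have horb1 : orbD EG EK G (1 : K) 1 = J := by
    rw [hJ, orbD]; simp only [hsmul, mul_one]
  have hβs : SmoothNear EG EK (fun p : EG ↦ k * ι (par EG (1 : G) p) * k⁻¹) 0 :=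
    (smoothNear_conj k _).comp_of_eq hιpar rfl
  have hβsrc : ∀ᶠ p in 𝓝 (0 : EG), k * ι (par EG (1 : G) p) * k⁻¹ ∈ src EK (1 : K) :=
    hβs.continuousAt (by simpa using src_mem_nhds (E := EK) (1 : K))
  -- The conjugated map is tangent to these cosets because `Ad k` preserves the range of `J`; the
  -- tube then keeps it in the image of `ι`.
  have hs0 := hβ (fun p : EG ↦ k * ι (par EG (1 : G) p) * k⁻¹) hβs (by simp) (by
    filter_upwards [hβsrc, (smoothNear_par_zero (E := EG) (1 : G)).eventually] with p hp hpar
    set y := k * ι (par EG (1 : G) p) * k⁻¹ with hy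
    rw [horb y hp, horb1]
    constructor
    · have hθG : SmoothNear EG EG (fun q : EG ↦ par EG (1 : G) q * (par EG (1 : G) p)⁻¹) p :=
        hpar.mul (smoothNear_const _ _)
      have hθι := (smoothNear_of_contMDiff hι _).comp_of_eq hθG rfl
      have h1 := hRfac y hp
        (fun q : EG ↦ k * ι (par EG (1 : G) q * (par EG (1 : G) p)⁻¹) * k⁻¹) p
        ((smoothNear_conj k _).comp_of_eq hθι rfl) (by simp)
      have h2 := fderiv_co_conj hθι (by simp) k
      have h3 := fderiv_co_hom ι hι hθG (by simp)
      have h4 : (fun q : EG ↦ co EK 1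
          (k * ι (par EG (1 : G) q * (par EG (1 : G) p)⁻¹) * k⁻¹ * y)) =
          fun q : EG ↦ co EK 1 (k * ι (par EG (1 : G) q) * k⁻¹) := by
        funext q
        simp only [hy, map_mul, map_inv]
        congr 1; group
      rw [h4, h2, h3] at h1
      rw [h1]
      rintro _ ⟨v, rfl⟩
      obtain ⟨w, hw⟩ := adj_mem_range ι hι hd k
        (fderiv ℝ (fun q : EG ↦ co EG 1 (par EG (1 : G) q * (par EG (1 : G) p)⁻¹)) p v)
      exact ⟨w, congrArg (fderiv ℝ (R y) 0) hw⟩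
    · have := finrank_range_comp_comp_le (LinearMap.id : EG →ₗ[ℝ] EG) (J : EG →ₗ[ℝ] EK)
        (fderiv ℝ (R y) 0 : EK →ₗ[ℝ] EK)
      rw [LinearMap.comp_id] at this
      exact this)
  refine ⟨c, hc, hc1, (eventually_nhds_one_iff (EA := EG)).2 ?_⟩
  have ht : Tendsto (fun p : EG ↦ k * ι (par EG (1 : G) p) * k⁻¹) (𝓝 0) (𝓝 1) := by
    simpa [ContinuousAt] using hβs.continuousAt
  filter_upwards [hs0, ht.eventually hcs] with p h1 h2
  rw [h1, par_zero, hsmul, mul_one] at h2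
  exact h2

end Normal

/-! ### Identity components of subgroups -/

section IdentityComponent

variable {G : Type*} [TopologicalSpace G] [Group G] [IsTopologicalGroup G]

theorem coe_identityComponent (S : Subgroup G) :
    (identityComponent S : Set G) = connectedComponentIn (S : Set G) 1 := by
  have h1 : (1 : G) ∈ (S : Set G) := S.one_mem
  rw [connectedComponentIn_eq_image h1]
  rfl

theorem identityComponent_map (α : G ≃* G) (h1 : Continuous α) (h2 : Continuous α.symm)
    (S : Subgroup G) :
    identityComponent (S.map α.toMonoidHom) = (identityComponent S).map α.toMonoidHom := by
  let e : G ≃ₜ G := ⟨α.toEquiv, h1, h2⟩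
  apply SetLike.coe_injective
  rw [coe_identityComponent, Subgroup.coe_map, Subgroup.coe_map, coe_identityComponent]
  have := e.image_connectedComponentIn (s := (S : Set G)) S.one_mem
  have he : e 1 = 1 := α.map_one
  rw [he] at this
  exact this.symm

/-- Agreement near `1` makes `S` open, hence clopen, in `T`, so the identity component of `T` lies
in `S`. -/
theorem identityComponent_eq_of_eventually {S T : Subgroup G} (hle : S ≤ T)
    (h : ∀ᶠ t in 𝓝 (1 : G), t ∈ T → t ∈ S) : identityComponent S = identityComponent T := by
  apply SetLike.coe_injective
  rw [coe_identityComponent, coe_identityComponent]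
  apply subset_antisymm (connectedComponentIn_mono _ hle)
  have hopen : IsOpen ((S.subgroupOf T : Subgroup T) : Set T) := by
    apply Subgroup.isOpen_of_mem_nhds (g := 1)
    have h2 : ∀ᶠ t : T in 𝓝 1, (t : G) ∈ T → (t : G) ∈ S :=
      (continuous_subtype_val.tendsto (1 : T)).eventually h
    filter_upwards [h2] with t ht
    exact Subgroup.mem_subgroupOf.2 (ht t.2)
  have hclopen : IsClopen ((S.subgroupOf T : Subgroup T) : Set T) :=
    ⟨Subgroup.isClosed_of_isOpen _ hopen, hopen⟩
  refine isPreconnected_connectedComponentIn.subset_connectedComponentIn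
    (mem_connectedComponentIn T.one_mem) ?_
  rw [connectedComponentIn_eq_image (F := (T : Set G)) T.one_mem]
  rintro _ ⟨t, ht, rfl⟩
  exact hclopen.connectedComponent_subset (S.subgroupOf T).one_mem ht

end IdentityComponent

/-! ### Automorphisms of `G` induced by conjugation in `K` -/

section ConjEquiv

variable {EG EK : Type*} [NormedAddCommGroup EG] [NormedSpace ℝ EG] [FiniteDimensional ℝ EG]
  [NormedAddCommGroup EK] [NormedSpace ℝ EK] [FiniteDimensional ℝ EK]
  {G : Type*} [TopologicalSpace G] [ChartedSpace EG G] [Group G] [LieGroup 𝓘(ℝ, EG) ∞ G]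
  {K : Type*} [TopologicalSpace K] [ChartedSpace EK K] [Group K] [LieGroup 𝓘(ℝ, EK) ∞ K]

/-- For fixed `k`, the elements of `G` whose conjugate stays in the image form a subgroup. It
contains a neighbourhood of `1` by `exists_conj_lift`, hence is all of the connected group `G`. -/
theorem range_normal [IsTopologicalGroup G] [ConnectedSpace G] (ι : G →* K)
    (hι : ContMDiff 𝓘(ℝ, EG) 𝓘(ℝ, EK) ∞ ι) (hd : DenseRange ι) : ι.range.Normal := by
  refine ⟨?_⟩
  rintro _ ⟨g, rfl⟩ k
  let S : Subgroup G := ι.range.comap ((MulAut.conj k).toMonoidHom.comp ι)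
  obtain ⟨c, -, -, hc⟩ := exists_conj_lift ι hι hd k
  have hopen : IsOpen (S : Set G) := by
    apply Subgroup.isOpen_of_mem_nhds (g := 1)
    filter_upwards [hc] with g hg
    exact ⟨_, hg⟩
  have hS : (S : Set G) = univ :=
    IsClopen.eq_univ ⟨Subgroup.isClosed_of_isOpen _ hopen, hopen⟩ ⟨1, S.one_mem⟩
  have : g ∈ (S : Set G) := hS ▸ mem_univ g
  exact this

omit [FiniteDimensional ℝ EK] [FiniteDimensional ℝ EG] in
theorem contMDiff_of_smoothNear_one {α : G →* K} (h : SmoothNear EG EK α 1) :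
    ContMDiff 𝓘(ℝ, EG) 𝓘(ℝ, EK) ∞ α := by
  intro g
  have h1 : SmoothNear EG EK (fun l : G ↦ α g * α (g⁻¹ * l)) g :=
    (smoothNear_const _ _).mul
      (h.comp_of_eq ((smoothNear_const (g⁻¹ : G) g).mul (smoothNear_id g)) (by simp))
  have h2 : (fun l : G ↦ α g * α (g⁻¹ * l)) = α := by
    funext l; rw [← map_mul, mul_inv_cancel_left]
  rw [h2] at h1
  exact h1.at

/-- Conjugation by `k ∈ K` restricts to a smooth automorphism of the dense Lie subgroup `G`. -/
theorem exists_conjEquiv [IsTopologicalGroup G] [ConnectedSpace G] (ι : G →* K)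
    (hι : ContMDiff 𝓘(ℝ, EG) 𝓘(ℝ, EK) ∞ ι) (hinj : Function.Injective ι) (hd : DenseRange ι) :
    ∃ α : K → G ≃* G, (∀ k g, ι (α k g) = k * ι g * k⁻¹) ∧
      (∀ k, ContMDiff 𝓘(ℝ, EG) 𝓘(ℝ, EG) ∞ (α k)) ∧
      ∀ k, ContMDiff 𝓘(ℝ, EG) 𝓘(ℝ, EG) ∞ (α k).symm := by
  have := range_normal ι hι hd
  let e : G ≃* ι.range := MonoidHom.ofInjective hinj
  let α : K → G ≃* G := fun k ↦ (e.trans (MulAut.conjNormal k)).trans e.symm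
  have hα : ∀ k g, ι (α k g) = k * ι g * k⁻¹ := by
    intro k g
    have h1 : ∀ z : ι.range, ι (e.symm z) = z := fun z ↦ by
      have : (e (e.symm z) : K) = z := by rw [e.apply_symm_apply]
      rw [← this]; rfl
    change ι (e.symm (MulAut.conjNormal k (e g))) = _
    rw [h1, MulAut.conjNormal_apply]; rfl
  have hsm : ∀ k, ContMDiff 𝓘(ℝ, EG) 𝓘(ℝ, EG) ∞ (α k) := by
    intro k
    refine contMDiff_of_smoothNear_one (α := (α k).toMonoidHom) ?_
    obtain ⟨c, hc, hc1, hck⟩ := exists_conj_lift ι hι hd k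
    have h1 : SmoothNear EG EG (fun g : G ↦ c (k * ι g * k⁻¹)) 1 :=
      hc.comp_of_eq ((smoothNear_conj k _).comp_of_eq (smoothNear_of_contMDiff hι 1) rfl) (by simp)
    refine h1.congr ?_
    filter_upwards [hck] with g hg
    -- Injectivity of `ι` identifies the algebraic automorphism with the smooth lift `c` near `1`;
    -- translations spread smoothness to all of `G`.
    exact hinj ((hα k g).trans hg.symm)
  refine ⟨α, hα, hsm, fun k ↦ ?_⟩
  have h1 : ((α k).symm : G → G) = α k⁻¹ := by
    funext g
    apply (α k).injective
    apply hinj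
    rw [(α k).apply_symm_apply, hα, hα]; group
  rw [h1]; exact hsm _

omit [FiniteDimensional ℝ EG] in
theorem map_tangentAtOne_le (α : G →* G) (hα : ContMDiff 𝓘(ℝ, EG) 𝓘(ℝ, EG) ∞ α)
    (S : Subgroup G) {v : GroupLieAlgebra 𝓘(ℝ, EG) G} (hv : v ∈ tangentAtOne EG S) :
    (fderiv ℝ (fun a ↦ co EG 1 (α (par EG (1 : G) a))) 0 v : GroupLieAlgebra 𝓘(ℝ, EG) G) ∈
      tangentAtOne EG (S.map α) := by
  let f : GroupLieAlgebra 𝓘(ℝ, EG) G →ₗ[ℝ] GroupLieAlgebra 𝓘(ℝ, EG) G :=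
    (fderiv ℝ (fun a ↦ co EG 1 (α (par EG (1 : G) a))) 0 : EG →ₗ[ℝ] EG)
  have hle : tangentAtOne EG S ≤ (tangentAtOne EG (S.map α)).comap f := by
    refine Submodule.span_le.2 ?_
    rintro _ ⟨γ, hγ, hS, h1, rfl⟩
    have hα1 : α (γ 0) = 1 := by simp [h1]
    refine Submodule.subset_span ⟨fun t ↦ α (γ t), hα.comp hγ, fun t ↦ ⟨γ t, hS t, rfl⟩, hα1, ?_⟩
    refine Eq.trans ?_ (mfderiv_curve_eq (hα.comp hγ) hα1).symm
    have h2 := congrArg (fun T ↦ T 1)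
      (fderiv_co_hom α hα (smoothNear_of_contMDiff hγ 0) h1)
    refine Eq.trans ?_ h2.symm
    exact congrArg (fderiv ℝ (fun a ↦ co EG 1 (α (par EG (1 : G) a))) 0) (mfderiv_curve_eq hγ h1)
  exact hle hv

/-- The derivative of `α` at `1` has that of `α.symm` as a left inverse, so it embeds one tangent
space into the other. -/
theorem subgroupDim_le_map (α : G ≃* G) (h1 : ContMDiff 𝓘(ℝ, EG) 𝓘(ℝ, EG) ∞ α)
    (h2 : ContMDiff 𝓘(ℝ, EG) 𝓘(ℝ, EG) ∞ α.symm) (S : Subgroup G) :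
    subgroupDim EG S ≤ subgroupDim EG (S.map α.toMonoidHom) := by
  set T := fderiv ℝ (fun a ↦ co EG 1 (α (par EG (1 : G) a))) 0 with hT
  let f : GroupLieAlgebra 𝓘(ℝ, EG) G →ₗ[ℝ] GroupLieAlgebra 𝓘(ℝ, EG) G := (T : EG →ₗ[ℝ] EG)
  have hf : Function.Injective f := by
    have hid : fderiv ℝ (fun a : EG ↦ co EG 1 (par EG (1 : G) a)) 0 = ContinuousLinearMap.id ℝ EG := by
      have : (fun a : EG ↦ co EG 1 (par EG (1 : G) a)) =ᶠ[𝓝 0] fun a ↦ a :=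
        (eventually_co_par (1 : G)).mono fun a ha ↦ ha.1
      rw [this.fderiv_eq]; exact fderiv_id
    have h3 := fderiv_co_hom α.symm.toMonoidHom h2 (θ := fun a : EG ↦ α (par EG (1 : G) a)) (p := 0)
      ((smoothNear_of_contMDiff h1 _).comp_of_eq (smoothNear_par_zero (1 : G)) rfl) (by simp)
    have h4 : (fun q : EG ↦ co EG 1 (α.symm.toMonoidHom (α (par EG (1 : G) q)))) =
        fun q ↦ co EG 1 (par EG (1 : G) q) := by
      funext q
      congr 1
      exact α.symm_apply_apply _
    rw [h4, hid] at h3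
    intro u w huw
    have h5 : T u = T w := huw
    have h6 : (u : EG) = _ := congrArg (fun T ↦ T u) h3
    have h7 : (w : EG) = _ := congrArg (fun T ↦ T w) h3
    exact h6.trans ((congrArg _ h5).trans h7.symm)
  have hle : (tangentAtOne EG S).map f ≤ tangentAtOne EG (S.map α.toMonoidHom) := by
    rintro _ ⟨v, hv, rfl⟩
    exact map_tangentAtOne_le α.toMonoidHom h1 S hv
  exact ((Submodule.equivMapOfInjective f hf _).finrank_eq).le.trans (Submodule.finrank_mono hle)

theorem subgroupDim_map (α : G ≃* G) (h1 : ContMDiff 𝓘(ℝ, EG) 𝓘(ℝ, EG) ∞ α)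
    (h2 : ContMDiff 𝓘(ℝ, EG) 𝓘(ℝ, EG) ∞ α.symm) (S : Subgroup G) :
    subgroupDim EG (S.map α.toMonoidHom) = subgroupDim EG S := by
  apply le_antisymm _ (subgroupDim_le_map α h1 h2 S)
  have := subgroupDim_le_map α.symm h2 h1 (S.map α.toMonoidHom)
  rw [Subgroup.map_map] at this
  have h3 : α.symm.toMonoidHom.comp α.toMonoidHom = MonoidHom.id G := by
    ext g; exact α.symm_apply_apply g
  rwa [h3, Subgroup.map_id] at this

end ConjEquiv

theorem exists_invariant_probabilityMeasure (H : Type*) [Group H] [TopologicalSpace H]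
    [IsTopologicalGroup H] [CompactSpace H] [MeasurableSpace H] [BorelSpace H] :
    ∃ μ : Measure H, IsProbabilityMeasure μ ∧ μ.IsMulLeftInvariant := by
  refine ⟨Measure.haarMeasure ⊤, ⟨?_⟩, inferInstance⟩
  have := Measure.haarMeasure_self (K₀ := (⊤ : TopologicalSpace.PositiveCompacts H))
  simpa using this

/-! ### Bochner linearization of the isotropy action -/

section Bochner

variable {EK : Type*} [NormedAddCommGroup EK] [NormedSpace ℝ EK]
  {K : Type*} [TopologicalSpace K] [ChartedSpace EK K] [Group K]
  {EM : Type u} [NormedAddCommGroup EM] [NormedSpace ℝ EM]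
  {M : Type*} [TopologicalSpace M] [ChartedSpace EM M] [MulAction K M]

variable (EM) in
/-- The action of `h`, in the chart centered at `x`. -/
noncomputable def actC (x : M) (h : K) (e : EM) : EM := co EM x (h • par EM x e)

variable (EM) in
/-- The isotropy representation at `x`, in the chart centered at `x`. -/
noncomputable def rho (x : M) (h : K) : EM →L[ℝ] EM := fderiv ℝ (actC EM x h) 0

omit [TopologicalSpace K] in
theorem actC_zero {x : M} {h : K} (hh : h ∈ MulAction.stabilizer K x) : actC EM x h 0 = 0 := by
  simp [actC, MulAction.mem_stabilizer_iff.1 hh]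

omit [TopologicalSpace K] in
theorem actC_actC {x : M} {h k : K} {e : EM} (hk : k • par EM x e ∈ src EM x) :
    actC EM x h (actC EM x k e) = actC EM x (h * k) e := by
  simp only [actC]
  rw [par_co hk, mul_smul]

variable [LieGroup 𝓘(ℝ, EK) ∞ K] [IsManifold 𝓘(ℝ, EM) ∞ M]
  [ContMDiffSMul 𝓘(ℝ, EK) 𝓘(ℝ, EM) ∞ K M]

theorem smoothNear_actC_of_mem (EK : Type*) [NormedAddCommGroup EK] [NormedSpace ℝ EK]
    {K : Type*} [TopologicalSpace K] [ChartedSpace EK K] [Group K]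
    {EM : Type u} [NormedAddCommGroup EM] [NormedSpace ℝ EM]
    {M : Type*} [TopologicalSpace M] [ChartedSpace EM M] [MulAction K M]
    [IsManifold 𝓘(ℝ, EM) ∞ M] [ContMDiffSMul 𝓘(ℝ, EK) 𝓘(ℝ, EM) ∞ K M]
    {x : M} {h : K} (hh : h ∈ MulAction.stabilizer K x) :
    SmoothNear EM EM (actC EM x h) 0 :=
  (smoothNear_co (mem_src_self x)).comp_of_eq
    ((smoothNear_const_smul EK h _).comp_of_eq (smoothNear_par_zero x) rfl)
    (by simp [MulAction.mem_stabilizer_iff.1 hh])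

theorem smoothNear_actC_family {x : M} {h₀ : K} {e₀ : EM} (hp : SmoothNear EM EM (par EM x) e₀)
    (hs : h₀ • par EM x e₀ ∈ src EM x) :
    SmoothNear (EK × EM) EM (fun z : EK × EM ↦ actC EM x (h₀ * par EK (1 : K) z.1) z.2)
      (0, e₀) := by
  have h1 : SmoothNear (EK × EM) EK (fun z : EK × EM ↦ par EK (1 : K) z.1) (0, e₀) :=
    (smoothNear_par_zero (1 : K)).comp_of_eq (smoothNear_of_contDiff contDiff_fst _) rfl
  have h2 : SmoothNear (EK × EM) EM (fun z : EK × EM ↦ par EM x z.2) (0, e₀) :=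
    hp.comp_of_eq (smoothNear_of_contDiff contDiff_snd _) rfl
  exact (smoothNear_co hs).comp_of_eq
    (((smoothNear_const h₀ _).mul h1).smul h2) (by simp)

theorem smoothNear_actC_inv_family {x : M} {h₀ : K} {e₀ : EM}
    (hp : SmoothNear EM EM (par EM x) e₀) (hs : h₀⁻¹ • par EM x e₀ ∈ src EM x) :
    SmoothNear (EK × EM) EM (fun z : EK × EM ↦ actC EM x (h₀ * par EK (1 : K) z.1)⁻¹ z.2)
      (0, e₀) := by
  have h1 : SmoothNear (EK × EM) EK (fun z : EK × EM ↦ par EK (1 : K) z.1) (0, e₀) :=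
    (smoothNear_par_zero (1 : K)).comp_of_eq (smoothNear_of_contDiff contDiff_fst _) rfl
  have h2 : SmoothNear (EK × EM) EM (fun z : EK × EM ↦ par EM x z.2) (0, e₀) :=
    hp.comp_of_eq (smoothNear_of_contDiff contDiff_snd _) rfl
  exact (smoothNear_co hs).comp_of_eq
    (((smoothNear_const h₀ _).mul h1).inv.smul h2) (by simp)

omit [TopologicalSpace K] [IsManifold 𝓘(ℝ, EM) ∞ M] in
theorem rho_one (x : M) : rho EM x (1 : K) = ContinuousLinearMap.id ℝ EM := by
  have : actC EM x (1 : K) =ᶠ[𝓝 0] fun e ↦ e := by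
    filter_upwards [eventually_co_par x] with e he
    simp [actC, he.1]
  rw [rho, this.fderiv_eq]; exact fderiv_id

include EK in
omit [LieGroup 𝓘(ℝ, EK) ∞ K] in
theorem rho_mul {x : M} {h k : K} (hh : h ∈ MulAction.stabilizer K x)
    (hk : k ∈ MulAction.stabilizer K x) : rho EM x (h * k) = (rho EM x h).comp (rho EM x k) := by
  refine fderiv_eq_comp_of_eventuallyEq ?_ (actC_zero hk) (smoothNear_actC_of_mem EK hh)
    (smoothNear_actC_of_mem EK hk)
  have hin : SmoothNear EM EM (fun e : EM ↦ k • par EM x e) 0 :=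
    (smoothNear_const_smul EK k _).comp_of_eq (smoothNear_par_zero x) rfl
  have : ∀ᶠ e in 𝓝 (0 : EM), k • par EM x e ∈ src EM x :=
    hin.continuousAt (by
      simpa [MulAction.mem_stabilizer_iff.1 hk] using src_mem_nhds (E := EM) x)
  filter_upwards [this] with e he
  rw [actC_actC he]

/-- The points near `x` in whose orbit under the isotropy group of `x` one stays in the chart. -/
def goodSet (EM : Type*) [NormedAddCommGroup EM] [NormedSpace ℝ EM] (K : Type*) [Group K]
    {M : Type*} [TopologicalSpace M] [ChartedSpace EM M] [MulAction K M] (x : M) : Set EM :=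
  {e | SmoothNear EM EM (par EM x) e ∧ ∀ h ∈ MulAction.stabilizer K x, h • par EM x e ∈ src EM x}

omit [TopologicalSpace K] in
theorem zero_mem_goodSet (x : M) : (0 : EM) ∈ goodSet EM K x :=
  ⟨smoothNear_par_zero x, fun h hh ↦ by
    simpa [MulAction.mem_stabilizer_iff.1 hh] using mem_src_self (E := EM) x⟩

/-- The integrand of the averaged chart. Elements near `h₀` are written `h₀ * par EK 1 q`, so the
smooth parameter `q` lives in the model space of `K`, although `h` runs over a subgroup only. -/
theorem locSmoothFamily_average (x : M) : LocSmoothFamily EK (goodSet EM K x)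
    fun (h : MulAction.stabilizer K x) e ↦ rho EM x (h : K) (actC EM x (h : K)⁻¹ e) := by
  intro h₀ e₀ he₀
  refine ⟨fun h ↦ co EK 1 ((h₀ : K)⁻¹ * h),
    fun z ↦ fderiv ℝ (actC EM x ((h₀ : K) * par EK (1 : K) z.1)) 0
      (actC EM x ((h₀ : K) * par EK (1 : K) z.1)⁻¹ z.2), ?_, ?_, ?_⟩
  · have hq : SmoothNear EK EK (fun k : K ↦ co EK 1 ((h₀ : K)⁻¹ * k)) h₀ :=
      (smoothNear_co (mem_src_self (1 : K))).comp_of_eq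
        ((smoothNear_const _ _).mul (smoothNear_id _)) (by simp)
    exact ContinuousAt.comp (f := Subtype.val) hq.continuousAt continuous_subtype_val.continuousAt
  · have h1 := eventually_contDiffAt_partial_fderiv (smoothNear_vec_iff.1
      (smoothNear_actC_family (EK := EK) (smoothNear_par_zero x) (h₀ := (h₀ : K))
        ((zero_mem_goodSet (EM := EM) (K := K) x).2 h₀ h₀.2)))
    have h2 := smoothNear_vec_iff.1 (smoothNear_actC_inv_family (EK := EK) he₀.1 (h₀ := (h₀ : K))
        (he₀.2 _ (inv_mem h₀.2)))
    have h3 : Tendsto (fun z : EK × EM ↦ (z.1, (0 : EM)))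
        (𝓝 (co EK 1 ((h₀ : K)⁻¹ * h₀), e₀)) (𝓝 (0, 0)) := by
      have : Continuous fun z : EK × EM ↦ (z.1, (0 : EM)) := by fun_prop
      simpa using this.tendsto (co EK 1 ((h₀ : K)⁻¹ * h₀), e₀)
    have h4 := h3.eventually h1
    simp only [inv_mul_cancel, co_self] at h4 ⊢
    filter_upwards [h4, h2] with z hz1 hz2
    refine ContDiffAt.clm_apply ?_ hz2
    exact ContDiffAt.comp (g := fun z : EK × EM ↦
      fderiv ℝ (fun e ↦ actC EM x ((h₀ : K) * par EK (1 : K) z.1) e) z.2)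
      (f := fun z : EK × EM ↦ (z.1, (0 : EM))) z hz1 (by fun_prop)
  · have hs : ∀ᶠ k in 𝓝 (h₀ : K), (h₀ : K)⁻¹ * k ∈ src EK (1 : K) :=
      (((smoothNear_const (E := EK) (F := EK) ((h₀ : K)⁻¹) (h₀ : K)).mul
        (smoothNear_id _)).continuousAt) (by simpa using src_mem_nhds (E := EK) (1 : K))
    have ht : Tendsto (fun z : MulAction.stabilizer K x × EM ↦ (z.1 : K)) (𝓝 (h₀, e₀))
        (𝓝 (h₀ : K)) :=
      (continuous_subtype_val.comp continuous_fst).tendsto (h₀, e₀)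
    filter_upwards [ht.eventually hs] with z hz
    rw [par_co hz, mul_inv_cancel_left]
    rfl

variable [CompactSpace K] [T2Space M]

theorem compactSpace_stabilizer (EK EM : Type*) [NormedAddCommGroup EK] [NormedSpace ℝ EK]
    (K : Type*) [TopologicalSpace K] [ChartedSpace EK K] [Group K]
    [NormedAddCommGroup EM] [NormedSpace ℝ EM]
    {M : Type*} [TopologicalSpace M] [ChartedSpace EM M] [MulAction K M]
    [ContMDiffSMul 𝓘(ℝ, EK) 𝓘(ℝ, EM) ∞ K M] [CompactSpace K] [T2Space M] (x : M) :
    IsCompact (MulAction.stabilizer K x : Set K) := by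
  have := ContMDiffSMul.continuousSMul (I := 𝓘(ℝ, EK)) (I' := 𝓘(ℝ, EM)) (G := K) (M := M) ∞
  have hc : Continuous fun k : K ↦ k • x := by fun_prop
  have : IsClosed (MulAction.stabilizer K x : Set K) := isClosed_singleton.preimage hc
  exact this.isCompact

include EK in
omit [LieGroup 𝓘(ℝ, EK) ∞ K] in
-- The isotropy group is compact and fixes `x`, so a single neighbourhood serves for all its
-- elements.
theorem goodSet_mem_nhds (x : M) : goodSet EM K x ∈ 𝓝 (0 : EM) := by
  have hcs := ContMDiffSMul.continuousSMul (I := 𝓘(ℝ, EK)) (I' := 𝓘(ℝ, EM)) (G := K) (M := M) ∞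
  have h2 : ∀ᶠ e in 𝓝 (0 : EM), ∀ h ∈ (MulAction.stabilizer K x : Set K),
      h • par EM x e ∈ src EM x := by
    refine (compactSpace_stabilizer EK EM K x).eventually_forall_of_forall_eventually
      (P := fun e h ↦ h • par EM x e ∈ src EM x) fun h hh ↦ ?_
    have hc : ContinuousAt (fun z : EM × K ↦ z.2 • par EM x z.1) (0, h) :=
      continuousAt_snd.smul (ContinuousAt.comp_of_eq (f := Prod.fst)
        (smoothNear_par_zero (E := EM) x).continuousAt continuousAt_fst rfl)
    have hh' : h • x = x := hh
    exact hc (by simpa [hh'] using src_mem_nhds (E := EM) x)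
  filter_upwards [(smoothNear_par_zero (E := EM) x).eventually, h2] with e he1 he2
    using ⟨he1, he2⟩

variable [FiniteDimensional ℝ EM]

/-- Near `x`, the action of the isotropy group of `x` is linear in a suitable smooth chart. -/
theorem exists_equivariant_chart (EK : Type*) [NormedAddCommGroup EK] [NormedSpace ℝ EK]
    (K : Type*) [TopologicalSpace K] [ChartedSpace EK K] [Group K]
    {EM : Type u} [NormedAddCommGroup EM] [NormedSpace ℝ EM]
    {M : Type*} [TopologicalSpace M] [ChartedSpace EM M] [MulAction K M]
    [LieGroup 𝓘(ℝ, EK) ∞ K] [IsManifold 𝓘(ℝ, EM) ∞ M]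
    [ContMDiffSMul 𝓘(ℝ, EK) 𝓘(ℝ, EM) ∞ K M]
    [CompactSpace K] [T2Space M] [FiniteDimensional ℝ EM] (x : M) :
    ∃ σ : EM → M, SmoothNear EM EM σ 0 ∧ σ 0 = x ∧
      HasFDerivAt (fun n ↦ co EM x (σ n)) (ContinuousLinearMap.id ℝ EM) 0 ∧
      ∀ᶠ n in 𝓝 (0 : EM), ∀ h ∈ MulAction.stabilizer K x, σ (rho EM x h n) = h • σ n := by
  have : CompleteSpace EM := FiniteDimensional.complete ℝ EM
  have hcs := ContMDiffSMul.continuousSMul (I := 𝓘(ℝ, EK)) (I' := 𝓘(ℝ, EM)) (G := K) (M := M) ∞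
  have : IsTopologicalGroup K := topologicalGroup_of_lieGroup 𝓘(ℝ, EK) ∞
  have hHc := compactSpace_stabilizer EK EM K x
  have : CompactSpace (MulAction.stabilizer K x) := isCompact_iff_compactSpace.1 hHc
  let _ : MeasurableSpace (MulAction.stabilizer K x) := borel _
  have : BorelSpace (MulAction.stabilizer K x) := ⟨rfl⟩
  obtain ⟨μ, hμ, hμinv⟩ := exists_invariant_probabilityMeasure (MulAction.stabilizer K x)
  obtain ⟨U, hUg, hUo, hU0⟩ := mem_nhds_iff.1 (goodSet_mem_nhds (EK := EK) (EM := EM) (K := K) x)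
  have hfam : LocSmoothFamily EK U
      fun (h : MulAction.stabilizer K x) e ↦ rho EM x (h : K) (actC EM x (h : K)⁻¹ e) :=
    fun h e he ↦ locSmoothFamily_average x h e (hUg he)
  -- Averaging `ρ(h) ∘ h⁻¹` makes the chart intertwine the action with its linearization. At `0`
  -- every integrand has derivative `ρ(h) ρ(h⁻¹) = id`, so `ψ` is locally invertible.
  let ψ : EM → EM := fun e ↦
    ∫ h : MulAction.stabilizer K x, rho EM x (h : K) (actC EM x (h : K)⁻¹ e) ∂μ
  have hψ0 : ψ 0 = 0 := by
    have h1 : ∀ h : MulAction.stabilizer K x, rho EM x (h : K) (actC EM x (h : K)⁻¹ 0) = 0 :=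
      fun h ↦ by rw [actC_zero (inv_mem h.2), map_zero]
    simp only [ψ, h1, integral_zero]
  have hψs : ∀ᶠ e in 𝓝 (0 : EM), ContDiffAt ℝ ∞ ψ e := by
    filter_upwards [hUo.mem_nhds hU0] with e he
    exact (hfam.contDiffOn_integral μ hUo).contDiffAt (hUo.mem_nhds he)
  have hψ' : HasFDerivAt ψ ((ContinuousLinearEquiv.refl ℝ EM : EM ≃L[ℝ] EM) : EM →L[ℝ] EM) 0 := by
    have h1 := hfam.hasFDerivAt_integral μ hUo hU0
    convert h1 using 1
    have h2 : ∀ h : MulAction.stabilizer K x,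
        fderiv ℝ (fun e ↦ rho EM x (h : K) (actC EM x (h : K)⁻¹ e)) 0 =
          ContinuousLinearMap.id ℝ EM := by
      intro h
      have h3 : HasFDerivAt (fun e ↦ rho EM x (h : K) (actC EM x (h : K)⁻¹ e))
          ((rho EM x (h : K)).comp (rho EM x (h : K)⁻¹)) 0 :=
        (rho EM x (h : K)).hasFDerivAt.comp 0
          (smoothNear_actC_of_mem EK (inv_mem h.2)).differentiableAt.hasFDerivAt
      rw [h3.fderiv, ← rho_mul (EK := EK) h.2 (inv_mem h.2), mul_inv_cancel, rho_one]
    simp only [h2]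
    simp
  have hψeq : ∀ e ∈ U, ∀ k ∈ MulAction.stabilizer K x,
      ψ (actC EM x k e) = rho EM x k (ψ e) := by
    intro e he k hk
    simp only [ψ]
    -- Substitute `k * h` for `h` on the left, by invariance of the measure; then `(k * h)⁻¹ * k =
    -- h⁻¹`.
    rw [← ContinuousLinearMap.integral_comp_comm _
      (integrable_of_continuous_compact μ (hfam.continuous_left he)),
      ← integral_mul_left_eq_self _ (⟨k, hk⟩ : MulAction.stabilizer K x)]
    congr 1; funext h
    have h1 : rho EM x (k * h) = (rho EM x k).comp (rho EM x (h : K)) :=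
      rho_mul (EK := EK) hk h.2
    have h2 : (k * (h : K))⁻¹ * k = (h : K)⁻¹ := by group
    simp only [Subgroup.coe_mul]
    rw [actC_actC ((hUg he).2 k hk), h1, h2]
    rfl
  obtain ⟨g, hg0, hg, hgψ, hψg⟩ := exists_smooth_local_inverse hψs hψ'
  rw [hψ0] at hg0 hg hψg
  have hgs : SmoothNear EM EM g 0 := smoothNear_vec_iff.2 hg
  refine ⟨fun n ↦ par EM x (g n), (smoothNear_par_zero x).comp_of_eq hgs hg0, by simp [hg0],
    ?_, ?_⟩
  · have hgt : Tendsto g (𝓝 0) (𝓝 0) := by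
      have := hgs.continuousAt
      rwa [ContinuousAt, hg0] at this
    have h1 : (fun n ↦ co EM x (par EM x (g n))) =ᶠ[𝓝 0] g :=
      (hgt.eventually (eventually_co_par x)).mono fun n hn ↦ hn.1
    refine HasFDerivAt.congr_of_eventuallyEq ?_ h1
    have h2 := fderiv_eq_comp_of_eventuallyEq (f := fun e : EM ↦ e) (g := ψ) (h := g) (x := 0)
      (y := 0) (hψg.mono fun e he ↦ he.symm) hg0 (smoothNear_vec_iff.2 hψs) hgs
    rw [hψ'.fderiv] at h2
    have h3 : fderiv ℝ g 0 = ContinuousLinearMap.id ℝ EM := by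
      rw [fderiv_fun_id] at h2
      exact h2.symm
    rw [← h3]; exact hgs.differentiableAt.hasFDerivAt
  -- The inverse relation `g ∘ ψ = id` holds only near `0`; compactness keeps the translates of `g
  -- n` there for all `h` at once.
  · have hev : ∀ᶠ n in 𝓝 (0 : EM), ∀ h ∈ (MulAction.stabilizer K x : Set K),
        g (ψ (actC EM x h (g n))) = actC EM x h (g n) := by
      refine hHc.eventually_forall_of_forall_eventually
        (P := fun n h ↦ g (ψ (actC EM x h (g n))) = actC EM x h (g n)) fun h hh ↦ ?_
      have hh' : h • x = x := hh
      have hc : ContinuousAt (fun z : EM × K ↦ actC EM x z.2 (g z.1)) (0, h) := by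
        have h1 : ContinuousAt (fun z : EM × K ↦ par EM x (g z.1)) (0, h) :=
          ContinuousAt.comp_of_eq (f := Prod.fst) (g := fun n ↦ par EM x (g n))
            ((smoothNear_par_zero x).comp_of_eq hgs hg0).continuousAt continuousAt_fst rfl
        exact ContinuousAt.comp_of_eq (g := co EM x) (f := fun z : EM × K ↦ z.2 • par EM x (g z.1))
          (smoothNear_co (mem_src_self x)).continuousAt (continuousAt_snd.smul h1)
          (by simp [hg0, hh'])
      have h0 : actC EM x h (g 0) = 0 := by rw [hg0]; exact actC_zero hh
      rw [ContinuousAt] at hc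
      simp only [h0] at hc
      exact hc.eventually hgψ
    have hgU : ∀ᶠ n in 𝓝 (0 : EM), g n ∈ U :=
      hgs.continuousAt (by rw [hg0]; exact hUo.mem_nhds hU0)
    filter_upwards [hev, hgU, hψg] with n h1 h2 h3 h hh
    have h4 := h1 h hh
    rw [hψeq _ h2 h hh, h3] at h4
    rw [h4, actC, par_co ((hUg h2).2 h hh)]

end Bochner

/-- If `u` lies in the open segment between `v` and `w`, where `w` is a nearest point to `v` in
its orbit, then every isometry `T` of the group that fixes `u` fixes both `v` and `w`. -/
theorem eq_of_fixes_segment {E : Type*} [AddCommGroup E] [Module ℝ E] {B : LinearMap.BilinForm ℝ E}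
    (hsymm : B.IsSymm) (hpos : ∀ v, v ≠ 0 → 0 < B v v) {T : E →ₗ[ℝ] E}
    (hT : ∀ u v, B (T u) (T v) = B u v) {v w : E} (hmax : B v (T w) ≤ B v w) {t : ℝ}
    (h0 : 0 < t) (h1 : t < 1) (hfix : T ((1 - t) • v + t • w) = (1 - t) • v + t • w) :
    T v = v ∧ T w = w := by
  have hq : B (v - T v) (v - T v) = 2 * (B v v - B v (T v)) := by
    simp only [map_sub, LinearMap.sub_apply, hT, hsymm.eq (T v) v]
    ring
  have hnn : 0 ≤ B (v - T v) (v - T v) := by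
    rcases eq_or_ne (v - T v) 0 with h | h
    · simp [h]
    · exact (hpos _ h).le
  have h2 := congrArg (B v) hfix
  simp only [map_add, map_smul, smul_eq_mul] at h2
  have h3 : B v (T v) ≤ B v v := by linarith
  have h4 : B v v - B v (T v) = 0 := by
    -- Pairing the fixed point with `v` gives a positive combination of two nonnegative defects
    -- equal to zero. So `B v (T v) = B v v`, which for an isometry forces `T v = v`.
    have h5 : (1 - t) * (B v v - B v (T v)) + t * (B v w - B v (T w)) = 0 := by linarith
    have h6 : 0 ≤ t * (B v w - B v (T w)) := mul_nonneg h0.le (sub_nonneg.2 hmax)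
    have h7 : 0 ≤ (1 - t) * (B v v - B v (T v)) :=
      mul_nonneg (by linarith) (sub_nonneg.2 h3)
    have h8 : (1 - t) * (B v v - B v (T v)) = 0 := by linarith
    exact (mul_eq_zero.1 h8).resolve_left (by linarith)
  have hv : T v = v := by
    by_contra hne
    have := hpos (v - T v) (fun h ↦ hne (sub_eq_zero.1 h).symm)
    rw [hq, h4] at this
    simp at this
  refine ⟨hv, ?_⟩
  rw [map_add, map_smul, map_smul, hv, add_right_inj] at hfix
  exact smul_right_injective E h0.ne' hfix

/-! ### Invariant inner product and the slice theorem -/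

section Slice

variable {EK : Type*} [NormedAddCommGroup EK] [NormedSpace ℝ EK]
  {K : Type*} [TopologicalSpace K] [ChartedSpace EK K] [Group K]
  {EM : Type u} [NormedAddCommGroup EM] [NormedSpace ℝ EM]
  {M : Type*} [TopologicalSpace M] [ChartedSpace EM M] [MulAction K M]
  [LieGroup 𝓘(ℝ, EK) ∞ K] [IsManifold 𝓘(ℝ, EM) ∞ M]
  [ContMDiffSMul 𝓘(ℝ, EK) 𝓘(ℝ, EM) ∞ K M]

variable (EK) in
include EK in
theorem continuous_rho (x : M) :
    Continuous fun h : MulAction.stabilizer K x ↦ rho EM x (h : K) := by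
  have hfam : LocSmoothFamily EK (goodSet EM K x)
      fun (h : MulAction.stabilizer K x) e ↦ actC EM x (h : K) e := by
    intro h₀ e₀ he₀
    refine ⟨fun h ↦ co EK 1 ((h₀ : K)⁻¹ * h),
      fun z ↦ actC EM x ((h₀ : K) * par EK (1 : K) z.1) z.2, ?_, ?_, ?_⟩
    · have hq : SmoothNear EK EK (fun k : K ↦ co EK 1 ((h₀ : K)⁻¹ * k)) h₀ :=
        (smoothNear_co (mem_src_self (1 : K))).comp_of_eq
          ((smoothNear_const _ _).mul (smoothNear_id _)) (by simp)
      exact ContinuousAt.comp (f := Subtype.val) hq.continuousAt continuous_subtype_val.continuousAt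
    · have h1 := smoothNear_vec_iff.1
        (smoothNear_actC_family (EK := EK) he₀.1 (h₀ := (h₀ : K)) (he₀.2 h₀ h₀.2))
      simpa only [inv_mul_cancel, co_self] using h1
    · have hs : ∀ᶠ k in 𝓝 (h₀ : K), (h₀ : K)⁻¹ * k ∈ src EK (1 : K) :=
        (((smoothNear_const (E := EK) (F := EK) ((h₀ : K)⁻¹) (h₀ : K)).mul
          (smoothNear_id _)).continuousAt) (by simpa using src_mem_nhds (E := EK) (1 : K))
      have ht : Tendsto (fun z : MulAction.stabilizer K x × EM ↦ (z.1 : K)) (𝓝 (h₀, e₀))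
          (𝓝 (h₀ : K)) :=
        (continuous_subtype_val.comp continuous_fst).tendsto (h₀, e₀)
      filter_upwards [ht.eventually hs] with z hz
      rw [par_co hz, mul_inv_cancel_left]
  exact hfam.fderiv.continuous_left (zero_mem_goodSet x)

omit [LieGroup 𝓘(ℝ, EK) ∞ K] in
variable (EK) in
include EK in
theorem rho_inv_rho {x : M} {h : K} (hh : h ∈ MulAction.stabilizer K x) (v : EM) :
    rho EM x h⁻¹ (rho EM x h v) = v := by
  have := rho_mul (EK := EK) (EM := EM) (inv_mem hh) hh
  rw [inv_mul_cancel, rho_one] at this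
  exact (congrArg (fun T ↦ T v) this).symm

/-- For `h` fixing `x`, `h • a • x = (h * a * h⁻¹) • x`. Hence the isotropy representation preserves
the tangent space of the orbit, and so its orthogonal complement. -/
theorem rho_orbD {x : M} {h : K} (hh : h ∈ MulAction.stabilizer K x) :
    (rho EM x h).comp (orbD EK EM K x x) = (orbD EK EM K x x).comp (adj EK h) := by
  have hpar := smoothNear_par_zero (E := EK) (1 : K)
  have hθ : SmoothNear EK EK (fun a : EK ↦ h * par EK (1 : K) a * h⁻¹) 0 :=
    (smoothNear_conj h _).comp_of_eq hpar rfl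
  have h1 := fderiv_co_smul (mem_src_self (E := EM) x) hθ (by simp)
  have h2 := fderiv_eq_comp_of_eventuallyEq
    (f := fun a : EK ↦ co EM x ((h * par EK (1 : K) a * h⁻¹) • x)) (g := actC EM x h)
    (h := fun a : EK ↦ co EM x (par EK (1 : K) a • x)) (x := 0) (y := 0) ?_ (by simp)
    (smoothNear_actC_of_mem EK hh) (smoothNear_orbit_chart (mem_src_self x))
  · rw [h1] at h2
    exact h2.symm
  · have : ∀ᶠ a in 𝓝 (0 : EK), par EK (1 : K) a • x ∈ src EM x :=
      (smoothNear_orbit (EA := EK) (EM := EM) (A := K) x).continuousAt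
        (by simpa using src_mem_nhds (E := EM) x)
    filter_upwards [this] with a ha
    have hx : h⁻¹ • x = x := inv_mem hh
    rw [actC, par_co ha, mul_smul, mul_smul, hx]

variable [CompactSpace K] [T2Space M]

variable (EK EM) in
include EK in
/-- Averaging yields an inner product invariant under the isotropy representation. -/
theorem exists_invariant_bilinForm [FiniteDimensional ℝ EM] (x : M) : ∃ B : LinearMap.BilinForm ℝ EM, B.IsSymm ∧
    (∀ v, v ≠ 0 → 0 < B v v) ∧
    ∀ h ∈ MulAction.stabilizer K x, ∀ u v, B (rho EM x h u) (rho EM x h v) = B u v := by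
  have hcs := ContMDiffSMul.continuousSMul (I := 𝓘(ℝ, EK)) (I' := 𝓘(ℝ, EM)) (G := K) (M := M) ∞
  have : IsTopologicalGroup K := topologicalGroup_of_lieGroup 𝓘(ℝ, EK) ∞
  have hHc := compactSpace_stabilizer EK EM K x
  have : CompactSpace (MulAction.stabilizer K x) := isCompact_iff_compactSpace.1 hHc
  let _ : MeasurableSpace (MulAction.stabilizer K x) := borel _
  have : BorelSpace (MulAction.stabilizer K x) := ⟨rfl⟩
  obtain ⟨μ, hμ, hμinv⟩ := exists_invariant_probabilityMeasure (MulAction.stabilizer K x)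
  -- The model space carries only a norm, so an auxiliary inner product is borrowed before
  -- averaging.
  let T : EM ≃L[ℝ] EuclideanSpace ℝ (Fin (Module.finrank ℝ EM)) := toEuclidean
  let R : MulAction.stabilizer K x → EM →L[ℝ] EM := fun h ↦ rho EM x ((h⁻¹ : _) : K)
  have hRc : Continuous R := (continuous_rho EK x).comp continuous_inv
  let b : EM → EM → MulAction.stabilizer K x → ℝ := fun u v h ↦ inner ℝ (T (R h u)) (T (R h v))
  have hbc : ∀ u v, Continuous (b u v) := fun u v ↦
    (T.continuous.comp (hRc.clm_apply continuous_const)).inner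
      (T.continuous.comp (hRc.clm_apply continuous_const))
  have hbi : ∀ u v, Integrable (b u v) μ := fun u v ↦ integrable_of_continuous_compact μ (hbc u v)
  let B : LinearMap.BilinForm ℝ EM := LinearMap.mk₂ ℝ (fun u v ↦ ∫ h, b u v h ∂μ)
    (fun u u' v ↦ by
      rw [← integral_add (hbi _ _) (hbi _ _)]
      congr 1; funext h; simp only [b, map_add, inner_add_left])
    (fun c u v ↦ by
      rw [smul_eq_mul, ← integral_const_mul]
      congr 1; funext h; simp only [b, map_smul, real_inner_smul_left])
    (fun u v v' ↦ by
      rw [← integral_add (hbi _ _) (hbi _ _)]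
      congr 1; funext h; simp only [b, map_add, inner_add_right])
    (fun c u v ↦ by
      rw [smul_eq_mul, ← integral_const_mul]
      congr 1; funext h; simp only [b, map_smul, real_inner_smul_right])
  have hB : ∀ u v, B u v = ∫ h, b u v h ∂μ := fun u v ↦ rfl
  refine ⟨B, ⟨fun u v ↦ ?_⟩, fun v hv ↦ ?_, fun k hk u v ↦ ?_⟩
  · rw [hB, hB]
    congr 1; funext h; exact real_inner_comm _ _
  · rw [hB, integral_pos_iff_support_of_nonneg (fun h ↦ real_inner_self_nonneg) (hbi v v)]
    have : Function.support (b v v) = univ := by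
      refine eq_univ_of_forall fun h ↦ ?_
      rw [Function.mem_support]
      refine (inner_self_ne_zero (𝕜 := ℝ)).2 ?_
      rw [Ne, EmbeddingLike.map_eq_zero_iff]
      intro h0
      apply hv
      have h1 := rho_inv_rho EK (EM := EM) (h⁻¹).2 v
      rw [← h1]
      change rho EM x ((h⁻¹ : _) : K)⁻¹ (R h v) = 0
      rw [h0, map_zero]
    rw [this, measure_univ]
    exact zero_lt_one
  · rw [hB, hB, ← integral_mul_left_eq_self (b (rho EM x k u) (rho EM x k v))
      (⟨k, hk⟩ : MulAction.stabilizer K x)]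
    congr 1; funext h
    have h1 : ∀ w, R (⟨k, hk⟩ * h) (rho EM x k w) = R h w := by
      intro w
      have h2 : ((((⟨k, hk⟩ : MulAction.stabilizer K x) * h)⁻¹ : MulAction.stabilizer K x) : K)
          = ((h⁻¹ : MulAction.stabilizer K x) : K) * k⁻¹ := by simp
      simp only [R]
      rw [h2, rho_mul (EK := EK) (h⁻¹).2 (inv_mem hk), ContinuousLinearMap.comp_apply,
        rho_inv_rho EK hk]
    simp only [b, h1]

variable (EK) in
include EK in
/-- The isotropy representation moves points near `0` uniformly little. -/
theorem eventually_forall_rho (x : M) {P : EM → Prop} (hP : ∀ᶠ n in 𝓝 0, P n) :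
    ∀ᶠ n in 𝓝 (0 : EM), ∀ h ∈ MulAction.stabilizer K x, P (rho EM x h n) := by
  have : CompactSpace (MulAction.stabilizer K x) :=
    isCompact_iff_compactSpace.1 (compactSpace_stabilizer EK EM K x)
  have h1 : ∀ᶠ n in 𝓝 (0 : EM), ∀ h ∈ (univ : Set (MulAction.stabilizer K x)),
      P (rho EM x (h : K) n) := by
    refine isCompact_univ.eventually_forall_of_forall_eventually
      (P := fun n (h : MulAction.stabilizer K x) ↦ P (rho EM x (h : K) n)) fun h _ ↦ ?_
    have hc : Continuous fun z : EM × MulAction.stabilizer K x ↦ rho EM x (z.2 : K) z.1 :=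
      ((continuous_rho EK x).comp continuous_snd).clm_apply continuous_fst
    have := hc.tendsto ((0 : EM), h)
    rw [map_zero] at this
    exact this.eventually hP
  filter_upwards [h1] with n hn h hh using hn ⟨h, hh⟩ (mem_univ _)

open scoped Pointwise in
/-- The slice theorem for an action of a compact Lie group. -/
theorem exists_slice (EK : Type*) [NormedAddCommGroup EK] [NormedSpace ℝ EK]
    (K : Type*) [TopologicalSpace K] [ChartedSpace EK K] [Group K]
    {EM : Type u} [NormedAddCommGroup EM] [NormedSpace ℝ EM]
    {M : Type*} [TopologicalSpace M] [ChartedSpace EM M] [MulAction K M]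
    [LieGroup 𝓘(ℝ, EK) ∞ K] [IsManifold 𝓘(ℝ, EM) ∞ M]
    [ContMDiffSMul 𝓘(ℝ, EK) 𝓘(ℝ, EM) ∞ K M] [CompactSpace K] [T2Space M]
    [FiniteDimensional ℝ EM] [FiniteDimensional ℝ EK] (x : M) :
    ∃ (B : LinearMap.BilinForm ℝ EM) (N : Submodule ℝ EM) (σ : EM → M) (c : M → K) (s : M → EM)
      (O : Set EM),
      (B.IsSymm ∧ (∀ v, v ≠ 0 → 0 < B v v) ∧
        ∀ h ∈ MulAction.stabilizer K x, ∀ u v, B (rho EM x h u) (rho EM x h v) = B u v) ∧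
      (SmoothNear EM EK c x ∧ ContinuousAt s x ∧ s x = 0 ∧ (∀ y, s y ∈ N) ∧
        ∀ᶠ y in 𝓝 x, c y • σ (s y) = y) ∧
      (IsOpen O ∧ 0 ∈ O ∧ Convex ℝ O) ∧ (σ 0 = x ∧ ∀ n ∈ O, ContinuousAt σ n) ∧
      (∀ h ∈ MulAction.stabilizer K x, (∀ n ∈ N, rho EM x h n ∈ N) ∧
        ∀ n ∈ O, rho EM x h n ∈ O ∧ σ (rho EM x h n) = h • σ n) ∧
      ∀ n ∈ N, n ∈ O → ∀ k : K, k • σ n = σ n →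
        k ∈ MulAction.stabilizer K x ∧ rho EM x k n = n := by
  have hcs := ContMDiffSMul.continuousSMul (I := 𝓘(ℝ, EK)) (I' := 𝓘(ℝ, EM)) (G := K) (M := M) ∞
  have : IsTopologicalGroup K := topologicalGroup_of_lieGroup 𝓘(ℝ, EK) ∞
  obtain ⟨B, hBs, hBp, hBi⟩ := exists_invariant_bilinForm (K := K) EK EM x
  obtain ⟨σ, hσ, hσ0, hσ', hσe⟩ := exists_equivariant_chart (EM := EM) EK K x
  set D := orbD EK EM K x x with hD
  have hN : IsCompl D.range (B.orthogonal D.range) := by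
    rw [LinearMap.BilinForm.isCompl_orthogonal_iff_disjoint hBs.isRefl, Submodule.disjoint_def]
    intro v hv hv'
    by_contra hne
    exact (hBp v hne).ne' (LinearMap.BilinForm.mem_orthogonal_iff.1 hv' v hv)
  set N := B.orthogonal D.range with hNdef
  have hrange : ∀ h ∈ MulAction.stabilizer K x, ∀ r ∈ D.range, rho EM x h r ∈ D.range := by
    rintro h hh _ ⟨v, rfl⟩
    exact ⟨adj EK h v, (congrArg (fun T ↦ T v) (rho_orbD (EM := EM) hh)).symm⟩
  have hNinv : ∀ h ∈ MulAction.stabilizer K x, ∀ n ∈ N, rho EM x h n ∈ N := by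
    intro h hh n hn
    refine LinearMap.BilinForm.mem_orthogonal_iff.2 fun r hr ↦ ?_
    have h1 := rho_inv_rho EK (EM := EM) (inv_mem hh) r
    rw [inv_inv] at h1
    rw [← h1, hBi h hh]
    exact LinearMap.BilinForm.mem_orthogonal_iff.1 hn _ (hrange _ (inv_mem hh) r hr)
  obtain ⟨c, s, hc, hc1, hs, hs0, hsN, hcs', htube, hβ⟩ := exists_tube x hσ hσ0 hσ' hN
  have horb := (eventually_nhds_one_iff (EA := EK) (P := fun k : K ↦ s (k • x) = 0)).2
    (hβ (fun p ↦ par EK (1 : K) p • x) (smoothNear_orbit x) (by simp) (eventually_orbit_tangent x))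
  rw [nhds_prod_eq] at htube
  obtain ⟨pa, hpa, pn, hpn, htube⟩ := eventually_prod_iff.1 htube
  have hkx : Tendsto (fun k : K ↦ k • x) (𝓝 1) (𝓝 x) := by
    have : Continuous fun k : K ↦ k • x := by fun_prop
    simpa using this.tendsto 1
  have hU : ∀ᶠ k in 𝓝 (1 : K), s (k • x) = 0 ∧ c (k • x) • σ (s (k • x)) = k • x ∧ pa (k • x) :=
    horb.and ((hkx.eventually hcs').and (hkx.eventually hpa))
  obtain ⟨U, hUP, hUo, hU1⟩ := mem_nhds_iff.1 hU
  -- An open neighbourhood of the isotropy group. By compactness of its complement, only elements of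
  -- `Ω` can fix a point near `x`, and these are an element of the isotropy group times one close to
  -- `1`.
  let Ω : Set K := (MulAction.stabilizer K x : Set K) * U
  have hΩ : IsOpen Ω := hUo.mul_left
  have hΩK : ∀ᶠ y in 𝓝 x, ∀ k ∈ Ωᶜ, k • y ≠ y := by
    refine hΩ.isClosed_compl.isCompact.eventually_forall_of_forall_eventually
      (P := fun y k ↦ k • y ≠ y) fun k hk ↦ ?_
    have hne : k • x ≠ x := fun h ↦ hk ⟨k, h, 1, hU1, mul_one k⟩
    have hcl : IsClosed {z : M × K | z.2 • z.1 = z.1} := isClosed_eq (by fun_prop) (by fun_prop)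
    exact hcl.isOpen_compl.mem_nhds hne
  have hσt : Tendsto σ (𝓝 0) (𝓝 x) := by
    have := hσ.continuousAt
    rwa [ContinuousAt, hσ0] at this
  -- the isotropy groups of the points of the slice
  have hstab : ∀ᶠ n in 𝓝 (0 : EM), n ∈ N → ∀ k : K, k • σ n = σ n →
      k ∈ MulAction.stabilizer K x ∧ rho EM x k n = n := by
    filter_upwards [hσt.eventually hΩK, eventually_forall_rho EK (K := K) x hpn, hσe]
      with n h1 h2 h3 hnN k hk
    have hsσ : ∀ h ∈ MulAction.stabilizer K x,
        c (σ (rho EM x h n)) = 1 ∧ s (σ (rho EM x h n)) = rho EM x h n := by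
      intro h hh
      have := htube hpa.self_of_nhds (h2 h hh) (hNinv h hh n hnN)
      simpa [hc1] using this
    have hkΩ : k ∈ Ω := by
      by_contra hk'
      exact h1 k hk' hk
    obtain ⟨h, hh, k₁, hk₁, rfl⟩ := hkΩ
    obtain ⟨hs1, hc2, hpa1⟩ := hUP hk₁
    rw [hs1, hσ0] at hc2
    have hm : (c (k₁ • x))⁻¹ * k₁ ∈ MulAction.stabilizer K x := by
      rw [MulAction.mem_stabilizer_iff, mul_smul, inv_smul_eq_iff, hc2]
    -- The equation `k • σ n = σ n` in tube coordinates. Applying `c` yields `c (k₁ • x)` on the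
    -- left and `1` on the right, so `k₁` fixes `x`; applying `s` afterwards gives `rho EM x k n =
    -- n`.
    have h4 : c (k₁ • x) • σ (rho EM x ((c (k₁ • x))⁻¹ * k₁) n) = σ (rho EM x h⁻¹ n) := by
      rw [h3 _ hm, h3 _ (inv_mem hh), smul_smul, mul_inv_cancel_left, eq_inv_smul_iff, smul_smul]
      exact hk
    have h5 := (htube hpa1 (h2 _ hm) (hNinv _ hm n hnN)).1
    simp only [h4] at h5
    rw [(hsσ _ (inv_mem hh)).1] at h5
    rw [← h5, inv_one, one_mul] at hm
    have hk' : h * k₁ ∈ MulAction.stabilizer K x := mul_mem hh hm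
    refine ⟨hk', ?_⟩
    have h6 := (hsσ _ hk').2
    have h7 := (hsσ 1 (one_mem _)).2
    rw [h3 _ hk'] at h6
    rw [rho_one, ContinuousLinearMap.id_apply] at h7
    change (h * k₁) • σ n = σ n at hk
    rw [hk, h7] at h6
    exact h6.symm
  obtain ⟨r, hr, hball⟩ := Metric.eventually_nhds_iff_ball.1 (hstab.and (hσe.and hσ))
  have hHcomp : CompactSpace (MulAction.stabilizer K x) :=
    isCompact_iff_compactSpace.1 (compactSpace_stabilizer EK EM K x)
  -- The norm need not be invariant, so the ball is replaced by the points whose whole isotropy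
  -- orbit stays in it. This set is invariant and convex, and open by compactness.
  let O : Set EM := {n | ∀ h ∈ MulAction.stabilizer K x, rho EM x h n ∈ Metric.ball 0 r}
  have hOb : O ⊆ Metric.ball 0 r := fun n hn ↦ by
    have := hn 1 (one_mem _)
    rwa [rho_one] at this
  refine ⟨B, N, σ, c, s, O, ⟨hBs, hBp, hBi⟩, ⟨hc, hs.continuousAt, hs0, hsN, hcs'⟩, ⟨?_, ?_, ?_⟩,
    ⟨hσ0, fun n hn ↦ (hball n (hOb hn)).2.2.continuousAt⟩,
    fun h hh ↦ ⟨hNinv h hh, fun n hn ↦ ⟨?_, (hball n (hOb hn)).2.1 h hh⟩⟩,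
    fun n hnN hn ↦ (hball n (hOb hn)).1 hnN⟩
  · rw [isOpen_iff_mem_nhds]
    intro n hn
    have h1 : ∀ᶠ n' in 𝓝 n, ∀ h ∈ (univ : Set (MulAction.stabilizer K x)),
        rho EM x (h : K) n' ∈ Metric.ball (0 : EM) r := by
      refine isCompact_univ.eventually_forall_of_forall_eventually
        (P := fun n' (h : MulAction.stabilizer K x) ↦
          rho EM x (h : K) n' ∈ Metric.ball (0 : EM) r) fun h _ ↦ ?_
      have hcont : Continuous fun z : EM × MulAction.stabilizer K x ↦ rho EM x (z.2 : K) z.1 :=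
        ((continuous_rho EK x).comp continuous_snd).clm_apply continuous_fst
      exact (hcont.tendsto (n, h)).eventually (Metric.isOpen_ball.mem_nhds (hn h h.2))
    filter_upwards [h1] with n' hn' h hh using hn' ⟨h, hh⟩ (mem_univ _)
  · intro h _
    rw [map_zero]
    exact Metric.mem_ball_self hr
  · intro u hu v hv a b ha hb hab h hh
    rw [map_add, map_smul, map_smul]
    exact convex_ball _ _ (hu h hh) (hv h hh) ha hb hab
  · intro k hk
    have := hn (k * h) (mul_mem hk hh)
    rwa [rho_mul (EK := EK) hk hh] at this

end Slice

/-! ### Conjugation of subgroups -/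

section Conjugate

variable {K : Type*} [Group K]

theorem conjugate_conjugate (k l : K) (S : Subgroup K) :
    conjugate k (conjugate l S) = conjugate (k * l) S := by
  simp only [conjugate, Subgroup.map_map, map_mul]
  rfl

theorem conjugate_one (S : Subgroup K) : conjugate 1 S = S := by
  simp only [conjugate, map_one]
  exact Subgroup.map_id S

end Conjugate

/-! ### Variation of isotropy groups and the regular points -/

section Strata

variable {EG : Type*} [NormedAddCommGroup EG] [NormedSpace ℝ EG] [FiniteDimensional ℝ EG]
  {G : Type*} [TopologicalSpace G] [ChartedSpace EG G] [Group G] [LieGroup 𝓘(ℝ, EG) ∞ G]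
  [IsTopologicalGroup G]
  {EK : Type*} [NormedAddCommGroup EK] [NormedSpace ℝ EK] [FiniteDimensional ℝ EK]
  {K : Type*} [TopologicalSpace K] [ChartedSpace EK K] [Group K] [LieGroup 𝓘(ℝ, EK) ∞ K]
  {EM : Type u} [NormedAddCommGroup EM] [NormedSpace ℝ EM] [FiniteDimensional ℝ EM]
  {M : Type*} [TopologicalSpace M] [ChartedSpace EM M] [IsManifold 𝓘(ℝ, EM) ∞ M]
  [MulAction K M] [ContMDiffSMul 𝓘(ℝ, EK) 𝓘(ℝ, EM) ∞ K M]
  [MulAction G M] [ContMDiffSMul 𝓘(ℝ, EG) 𝓘(ℝ, EM) ∞ G M]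

variable (EG G) in
/-- The points near which the dimension of the isotropy group is constant. -/
def locRegular {M : Type*} [TopologicalSpace M] [MulAction G M] : Set M :=
  {x | ∀ᶠ y in 𝓝 x, subgroupDim EG (MulAction.stabilizer G y) =
    subgroupDim EG (MulAction.stabilizer G x)}

/-- The isotropy groups of `x` and `y` have identity components conjugate in `K`. -/
def ConjIsotropy (ι : G →* K) (x y : M) : Prop :=
  ∃ k : K, (identityComponent (MulAction.stabilizer G x)).map ι =
    conjugate k ((identityComponent (MulAction.stabilizer G y)).map ι)

omit [TopologicalSpace K] [TopologicalSpace M] [MulAction K M] in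
theorem ConjIsotropy.symm {ι : G →* K} {x y : M} (h : ConjIsotropy ι x y) :
    ConjIsotropy ι y x := by
  obtain ⟨k, hk⟩ := h
  exact ⟨k⁻¹, by rw [hk, conjugate_conjugate, inv_mul_cancel, conjugate_one]⟩

omit [TopologicalSpace K] [TopologicalSpace M] [MulAction K M] in
theorem ConjIsotropy.trans {ι : G →* K} {x y z : M} (h : ConjIsotropy ι x y)
    (h' : ConjIsotropy ι y z) : ConjIsotropy ι x z := by
  obtain ⟨k, hk⟩ := h
  obtain ⟨l, hl⟩ := h'
  exact ⟨k * l, by rw [hk, hl, conjugate_conjugate]⟩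

theorem identityComponent_eq_of_near {x y : M} (hy : y ∈ src EM x)
    (hle : MulAction.stabilizer G y ≤ MulAction.stabilizer G x)
    (hdim : subgroupDim EG (MulAction.stabilizer G y) =
      subgroupDim EG (MulAction.stabilizer G x)) :
    identityComponent (MulAction.stabilizer G y) = identityComponent (MulAction.stabilizer G x) :=
  identityComponent_eq_of_eventually hle (eventually_mem_stabilizer hy hle hdim.ge)

variable {ι : G →* K} (hres : ∀ (g : G) (x : M), g • x = ι g • x)
  {α : K → G ≃* G} (hα : ∀ k g, ι (α k g) = k * ι g * k⁻¹)
  (hα1 : ∀ k, ContMDiff 𝓘(ℝ, EG) 𝓘(ℝ, EG) ∞ (α k))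
  (hα2 : ∀ k, ContMDiff 𝓘(ℝ, EG) 𝓘(ℝ, EG) ∞ (α k).symm)

include hres hα

omit [TopologicalSpace G] [IsTopologicalGroup G] [TopologicalSpace K] [TopologicalSpace M] in
theorem stabilizer_smul_eq_map (k : K) (y : M) :
    MulAction.stabilizer G (k • y) = (MulAction.stabilizer G y).map (α k).toMonoidHom := by
  have h1 : ∀ g, α k g ∈ MulAction.stabilizer G (k • y) ↔ g ∈ MulAction.stabilizer G y := by
    intro g
    rw [MulAction.mem_stabilizer_iff, MulAction.mem_stabilizer_iff, hres, hα, hres, mul_smul,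
      mul_smul, inv_smul_smul]
    exact (MulAction.injective k).eq_iff
  ext g
  constructor
  · intro hg
    refine ⟨(α k).symm g, (h1 _).1 ?_, (α k).apply_symm_apply g⟩
    rwa [(α k).apply_symm_apply]
  · rintro ⟨g, hg, rfl⟩
    exact (h1 g).2 hg

include hα1 hα2

omit [IsTopologicalGroup G] [TopologicalSpace K] [TopologicalSpace M] in
theorem subgroupDim_stabilizer_smul (k : K) (y : M) :
    subgroupDim EG (MulAction.stabilizer G (k • y)) =
      subgroupDim EG (MulAction.stabilizer G y) := by
  rw [stabilizer_smul_eq_map hres hα]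
  exact subgroupDim_map (α k) (hα1 k) (hα2 k) _

omit [FiniteDimensional ℝ EG] [LieGroup 𝓘(ℝ, EG) ∞ G] [TopologicalSpace K] [TopologicalSpace M] in
theorem map_identityComponent_smul (k : K) (y : M) :
    (identityComponent (MulAction.stabilizer G (k • y))).map ι =
      conjugate k ((identityComponent (MulAction.stabilizer G y)).map ι) := by
  rw [stabilizer_smul_eq_map hres hα,
    identityComponent_map _ (hα1 k).continuous (hα2 k).continuous, conjugate, Subgroup.map_map,
    Subgroup.map_map]
  congr 1
  ext g
  exact hα k g

omit [FiniteDimensional ℝ EG] [LieGroup 𝓘(ℝ, EG) ∞ G] [TopologicalSpace K] [TopologicalSpace M] in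
theorem conjIsotropy_smul (k : K) (y : M) : ConjIsotropy ι (k • y) y :=
  ⟨k, map_identityComponent_smul hres hα hα1 hα2 k y⟩

variable (EK EM)

include EK EM

omit [IsTopologicalGroup G] [FiniteDimensional ℝ EK] [LieGroup 𝓘(ℝ, EK) ∞ K] [FiniteDimensional ℝ EM]
  [IsManifold 𝓘(ℝ, EM) ∞ M] [ContMDiffSMul 𝓘(ℝ, EG) 𝓘(ℝ, EM) ∞ G M] in
theorem smul_mem_locRegular (k : K) {y : M} (hy : y ∈ locRegular EG G) :
    k • y ∈ locRegular EG G := by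
  have hcs := ContMDiffSMul.continuousSMul (I := 𝓘(ℝ, EK)) (I' := 𝓘(ℝ, EM)) (G := K) (M := M) ∞
  have ht : Tendsto (fun z : M ↦ k⁻¹ • z) (𝓝 (k • y)) (𝓝 y) := by
    simpa using (continuous_const_smul k⁻¹).tendsto (k • y)
  change ∀ᶠ z in 𝓝 (k • y), _
  filter_upwards [ht.eventually hy] with z hz
  rw [subgroupDim_stabilizer_smul hres hα hα1 hα2] at hz ⊢
  exact hz

variable [CompactSpace K] [T2Space M]

omit hα hα1 hα2 [TopologicalSpace G] [FiniteDimensional ℝ EG] [LieGroup 𝓘(ℝ, EG) ∞ G] [IsTopologicalGroup G]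
  [ContMDiffSMul 𝓘(ℝ, EG) 𝓘(ℝ, EM) ∞ G M] in
/-- Near `x`, every point is moved by a smooth `K`-valued function to a nearby point whose
isotropy group is contained in that of `x`. -/
theorem exists_smooth_reduction (x : M) : ∃ (c : M → K) (r : M → M), SmoothNear EM EK c x ∧
    ContinuousAt r x ∧ r x = x ∧ ∀ᶠ y in 𝓝 x, c y • r y = y ∧
      MulAction.stabilizer G (r y) ≤ MulAction.stabilizer G x := by
  obtain ⟨B, N, σ, c, s, O, -, ⟨hc, hs, hs0, hsN, hcs⟩, ⟨hO, hO0, -⟩, ⟨hσ0, hσc⟩, -, hstab⟩ :=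
    exists_slice (EM := EM) EK K x
  refine ⟨c, fun y ↦ σ (s y), hc, ContinuousAt.comp_of_eq (hσc 0 hO0) hs hs0, by
    simp only [hs0, hσ0], ?_⟩
  have hsO : ∀ᶠ y in 𝓝 x, s y ∈ O := hs (by rw [hs0]; exact hO.mem_nhds hO0)
  filter_upwards [hcs, hsO] with y h1 h2
  refine ⟨h1, fun g hg ↦ ?_⟩
  rw [MulAction.mem_stabilizer_iff, hres] at hg
  rw [MulAction.mem_stabilizer_iff, hres]
  exact (hstab _ (hsN y) h2 _ hg).1

omit [IsTopologicalGroup G] [ContMDiffSMul 𝓘(ℝ, EG) 𝓘(ℝ, EM) ∞ G M] in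
-- In the slice isotropy groups only shrink, and moving along `K`-orbits preserves their dimension.
theorem eventually_subgroupDim_le (x : M) : ∀ᶠ y in 𝓝 x,
    subgroupDim EG (MulAction.stabilizer G y) ≤ subgroupDim EG (MulAction.stabilizer G x) := by
  obtain ⟨c, r, -, -, -, h⟩ := exists_smooth_reduction EK EM hres x
  filter_upwards [h] with y ⟨h1, h2⟩
  rw [← h1, subgroupDim_stabilizer_smul hres hα hα1 hα2]
  exact subgroupDim_mono h2

/-- Constant dimension upgrades the inclusion of isotropy groups in the slice to equality of
identity components; the smooth factor `c y` then conjugates. -/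
theorem eventually_map_identityComponent {x : M} (hx : x ∈ locRegular EG G) :
    ∃ c : M → K, SmoothNear EM EK c x ∧ ∀ᶠ y in 𝓝 x,
      (identityComponent (MulAction.stabilizer G y)).map ι =
        conjugate (c y) ((identityComponent (MulAction.stabilizer G x)).map ι) := by
  obtain ⟨c, r, hc, hr, hrx, h⟩ :=
    exists_smooth_reduction EK EM hres x
  refine ⟨c, hc, ?_⟩
  have hsrc : ∀ᶠ y in 𝓝 x, r y ∈ src EM x := hr (by rw [hrx]; exact src_mem_nhds x)
  filter_upwards [h, hsrc, hx] with y ⟨h1, h2⟩ h3 h4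
  rw [← h1, subgroupDim_stabilizer_smul hres hα hα1 hα2] at h4
  rw [← identityComponent_eq_of_near h3 h2 h4,
    ← map_identityComponent_smul hres hα hα1 hα2, h1]

omit [IsTopologicalGroup G] [ContMDiffSMul 𝓘(ℝ, EG) 𝓘(ℝ, EM) ∞ G M] in
-- In any nonempty open set a point of minimal isotropy dimension qualifies, by upper
-- semicontinuity.
theorem dense_locRegular : Dense (locRegular EG G : Set M) := by
  rw [dense_iff_inter_open]
  rintro U hU ⟨x₀, hx₀⟩
  let d : M → ℕ := fun x ↦ subgroupDim EG (MulAction.stabilizer G x)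
  obtain ⟨x, hx, hmin⟩ := WellFounded.has_min (InvImage.wf d wellFounded_lt) U ⟨x₀, hx₀⟩
  refine ⟨x, hx, ?_⟩
  change ∀ᶠ y in 𝓝 x, _
  filter_upwards [hU.mem_nhds hx,
    eventually_subgroupDim_le EK EM hres hα hα1 hα2 x] with y h1 h2
  exact le_antisymm h2 (not_lt.1 (hmin y h1))

/-- Locally, regular points have conjugate isotropy groups. -/
theorem eventually_conjIsotropy (x : M) : ∃ W ∈ 𝓝 x, ∀ y ∈ W, ∀ z ∈ W,
    y ∈ locRegular EG G → z ∈ locRegular EG G → ConjIsotropy ι y z := by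
  obtain ⟨B, N, σ, c, s, O, ⟨hBs, hBp, hBi⟩, ⟨-, hs, hs0, hsN, hcs⟩, ⟨hO, hO0, hOc⟩, ⟨-, hσc⟩,
    hρ, hstab⟩ := exists_slice (EM := EM) EK K x
  have hsO : ∀ᶠ y in 𝓝 x, s y ∈ O := hs (by rw [hs0]; exact hO.mem_nhds hO0)
  refine ⟨_, hcs.and hsO, ?_⟩
  rintro y ⟨hy1, hy2⟩ z ⟨hz1, hz2⟩ hy hz
  set v := s y with hv
  have hvN : v ∈ N := hsN y
  -- a nearest point in the orbit
  obtain ⟨h₀, hh₀, hmax⟩ : ∃ h₀ ∈ MulAction.stabilizer K x, ∀ h ∈ MulAction.stabilizer K x,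
      B v (rho EM x h (s z)) ≤ B v (rho EM x h₀ (s z)) := by
    have : CompactSpace (MulAction.stabilizer K x) :=
      isCompact_iff_compactSpace.1 (compactSpace_stabilizer EK EM K x)
    have hcont : Continuous fun h : MulAction.stabilizer K x ↦ B v (rho EM x (h : K) (s z)) :=
      (LinearMap.continuous_of_finiteDimensional (B v)).comp
        ((continuous_rho EK x).clm_apply continuous_const)
    obtain ⟨h₀, -, hmax⟩ := isCompact_univ.exists_isMaxOn univ_nonempty hcont.continuousOn
    exact ⟨h₀, h₀.2, fun h hh ↦ hmax (mem_univ (⟨h, hh⟩ : MulAction.stabilizer K x))⟩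
  set w := rho EM x h₀ (s z) with hw
  have hwN : w ∈ N := (hρ h₀ hh₀).1 _ (hsN z)
  have hwO : w ∈ O := ((hρ h₀ hh₀).2 _ hz2).1
  have hσw : σ w = h₀ • σ (s z) := ((hρ h₀ hh₀).2 _ hz2).2
  have hmaxw : ∀ h ∈ MulAction.stabilizer K x, B v (rho EM x h w) ≤ B v w := by
    intro h hh
    have := hmax (h * h₀) (mul_mem hh hh₀)
    rwa [rho_mul (EK := EK) hh hh₀] at this
  have hvR : σ v ∈ locRegular EG G := by
    have := smul_mem_locRegular EK EM hres hα hα1 hα2 (c y)⁻¹ hy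
    rwa [inv_smul_eq_iff.2 hy1.symm] at this
  have hszR : σ (s z) ∈ locRegular EG G := by
    have := smul_mem_locRegular EK EM hres hα hα1 hα2 (c z)⁻¹ hz
    rwa [inv_smul_eq_iff.2 hz1.symm] at this
  have hwR : σ w ∈ locRegular EG G := hσw ▸ smul_mem_locRegular EK EM hres hα hα1 hα2 h₀ hszR
  -- the isotropy group is constant along the open segment
  let γ : ℝ → EM := fun t ↦ (1 - t) • v + t • w
  have hγN : ∀ t, γ t ∈ N := fun t ↦ N.add_mem (N.smul_mem _ hvN) (N.smul_mem _ hwN)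
  have hγO : ∀ t, 0 < t → t < 1 → γ t ∈ O := fun t h0 h1 ↦
    hOc hy2 hwO (by linarith) h0.le (by ring)
  have hγs : ∀ t, 0 < t → t < 1 → MulAction.stabilizer G (σ (γ t)) =
      MulAction.stabilizer G (σ v) ⊓ MulAction.stabilizer G (σ w) := by
    intro t h0 h1
    ext g
    simp only [Subgroup.mem_inf, MulAction.mem_stabilizer_iff, hres]
    constructor
    · intro hg
      obtain ⟨hgx, hgf⟩ := hstab _ (hγN t) (hγO t h0 h1) _ hg
      obtain ⟨hgv, hgw⟩ := eq_of_fixes_segment hBs hBp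
        (T := (rho EM x (ι g) : EM →ₗ[ℝ] EM)) (hBi _ hgx) (hmaxw _ hgx) h0 h1 hgf
      have h3 := ((hρ _ hgx).2 _ hy2).2
      have h4 := ((hρ _ hgx).2 _ hwO).2
      rw [ContinuousLinearMap.coe_coe] at hgv hgw
      rw [hgv] at h3
      rw [hgw] at h4
      exact ⟨h3.symm, h4.symm⟩
    · rintro ⟨hg1, hg2⟩
      obtain ⟨hgx, hgv⟩ := hstab _ hvN hy2 _ hg1
      obtain ⟨-, hgw⟩ := hstab _ hwN hwO _ hg2
      have h3 := ((hρ _ hgx).2 _ (hγO t h0 h1)).2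
      have h4 : rho EM x (ι g) (γ t) = γ t := by
        simp only [γ, map_add, map_smul, hgv, hgw]
      rw [h4] at h3
      exact h3.symm
  have hγc : Continuous γ := by fun_prop
  -- Treats both ends of the segment: `0` from the right and `1` from the left. For interior `t`
  -- near `t₀` regularity gives the intersection the dimension of the isotropy group at `t₀`, which
  -- contains it.
  have key : ∀ (t₀ : ℝ) (l : Filter ℝ) [l.NeBot], l ≤ 𝓝 t₀ → (∀ᶠ t in l, 0 < t ∧ t < 1) →
      γ t₀ ∈ O → σ (γ t₀) ∈ locRegular EG G →
      (MulAction.stabilizer G (σ v) ⊓ MulAction.stabilizer G (σ w) ≤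
        MulAction.stabilizer G (σ (γ t₀))) →
      identityComponent (MulAction.stabilizer G (σ v) ⊓ MulAction.stabilizer G (σ w)) =
        identityComponent (MulAction.stabilizer G (σ (γ t₀))) := by
    intro t₀ l _ hl hlt hO' hR hle
    have ht : Tendsto (fun t ↦ σ (γ t)) l (𝓝 (σ (γ t₀))) :=
      ((hσc _ hO').tendsto.comp (hγc.tendsto t₀)).mono_left hl
    obtain ⟨t, ⟨h0, h1⟩, h2, h3⟩ :=
      (hlt.and ((ht.eventually hR).and (ht.eventually (src_mem_nhds (E := EM) (σ (γ t₀)))))).exists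
    rw [← hγs t h0 h1] at hle ⊢
    exact identityComponent_eq_of_near h3 hle h2
  have hγ0 : γ 0 = v := by simp [γ]
  have hγ1 : γ 1 = w := by simp [γ]
  have hev0 : ∀ᶠ t in 𝓝[>] (0 : ℝ), 0 < t ∧ t < 1 := by
    filter_upwards [Ioo_mem_nhdsGT (zero_lt_one' ℝ)] with t ht using ht
  have hev1 : ∀ᶠ t in 𝓝[<] (1 : ℝ), 0 < t ∧ t < 1 := by
    filter_upwards [Ioo_mem_nhdsLT (zero_lt_one' ℝ)] with t ht using ht
  have e0 := key 0 (𝓝[>] 0) nhdsWithin_le_nhds hev0 (by rwa [hγ0]) (by rwa [hγ0])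
    (by rw [hγ0]; exact inf_le_left)
  have e1 := key 1 (𝓝[<] 1) nhdsWithin_le_nhds hev1 (by rwa [hγ1]) (by rwa [hγ1])
    (by rw [hγ1]; exact inf_le_right)
  rw [hγ0] at e0
  rw [hγ1] at e1
  have hvw : ConjIsotropy ι (σ v) (σ w) :=
    ⟨1, by rw [conjugate_one, ← e0, ← e1]⟩
  have h1 : ConjIsotropy ι y (σ v) := by
    have := conjIsotropy_smul hres hα hα1 hα2 (c y) (σ v)
    rwa [hy1] at this
  have h2 : ConjIsotropy ι z (σ (s z)) := by
    have := conjIsotropy_smul hres hα hα1 hα2 (c z) (σ (s z))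
    rwa [hz1] at this
  have h3 : ConjIsotropy ι (σ w) (σ (s z)) := by
    rw [hσw]; exact conjIsotropy_smul hres hα hα1 hα2 h₀ _
  exact h1.trans (hvw.trans (h3.trans h2.symm))

theorem conjIsotropy_of_locRegular [ConnectedSpace M] {y z : M} (hy : y ∈ locRegular EG G)
    (hz : z ∈ locRegular EG G) : ConjIsotropy ι y z := by
  -- The relation is stated with neighbourhoods so that it makes sense at singular points;
  -- transitivity passes through a regular point near the middle one, which exists by density.
  let P : M → M → Prop := fun x x' ↦ ∃ W ∈ 𝓝 x, ∃ W' ∈ 𝓝 x', ∀ y ∈ W, ∀ z ∈ W',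
    y ∈ locRegular EG G → z ∈ locRegular EG G → ConjIsotropy ι y z
  have hsymm : Std.Symm P := ⟨fun x x' ⟨W, hW, W', hW', h⟩ ↦
    ⟨W', hW', W, hW, fun y hy z hz hy' hz' ↦ (h z hz y hy hz' hy').symm⟩⟩
  have htrans : IsTrans M P := by
    refine ⟨fun x x' x'' ⟨W, hW, W', hW', h⟩ ⟨V, hV, V', hV', h'⟩ ↦
      ⟨W, hW, V', hV', fun y hy z hz hyR hzR ↦ ?_⟩⟩
    obtain ⟨q, hqR, hq⟩ := (dense_locRegular EK EM hres hα hα1 hα2).inter_nhds_nonempty (inter_mem hW' hV)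
    exact (h y hy q hq.1 hyR hqR).trans (h' q hq.2 z hz hqR hzR)
  have hP : P y z := by
    refine PreconnectedSpace.induction₂ P (fun x ↦ ?_) htrans y z
    obtain ⟨W, hW, h⟩ := eventually_conjIsotropy EK EM hres hα hα1 hα2 x
    filter_upwards [eventually_mem_nhds_iff.2 hW] with x' hx'
    exact ⟨W, hW, W, hx', h⟩
  obtain ⟨W, hW, W', hW', h⟩ := hP
  exact h y (mem_of_mem_nhds hW) z (mem_of_mem_nhds hW') hy hz

end Strata

end KillingFoliation

/-! ### The main theorem -/

theorem mainTheorem6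
    -- the connected Lie group `G`
    {EG : Type*} [NormedAddCommGroup EG] [NormedSpace ℝ EG] [FiniteDimensional ℝ EG]
    {G : Type*} [TopologicalSpace G] [ChartedSpace EG G] [Group G] [LieGroup 𝓘(ℝ, EG) ∞ G]
    [IsTopologicalGroup G] [T2Space G] [ConnectedSpace G]
    -- the compact Lie group `K`
    {EK : Type*} [NormedAddCommGroup EK] [NormedSpace ℝ EK] [FiniteDimensional ℝ EK]
    {K : Type*} [TopologicalSpace K] [ChartedSpace EK K] [Group K] [LieGroup 𝓘(ℝ, EK) ∞ K]
    [T2Space K] [CompactSpace K]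
    -- the manifold `M`
    {EM : Type*} [NormedAddCommGroup EM] [NormedSpace ℝ EM] [FiniteDimensional ℝ EM]
    {M : Type*} [TopologicalSpace M] [ChartedSpace EM M] [IsManifold 𝓘(ℝ, EM) ∞ M]
    [T2Space M] [SecondCountableTopology M] [ConnectedSpace M]
    -- `G` is a dense Lie subgroup of `K`, with inclusion `ι`
    (ι : G →* K) (hι_smooth : ContMDiff 𝓘(ℝ, EG) 𝓘(ℝ, EK) ∞ ι)
    (hι_inj : Function.Injective ι) (hι_dense : DenseRange ι)
    -- the smooth action of `K` on `M` and its restriction to `G`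
    [MulAction K M] [ContMDiffSMul 𝓘(ℝ, EK) 𝓘(ℝ, EM) ∞ K M]
    [MulAction G M] (hres : ∀ (g : G) (x : M), g • x = ι g • x)
    -- the base point
    (p : M) (hp : p ∈ KillingFoliation.regularStratum EG G M)
    (L : Subgroup G)
    (hL : L = KillingFoliation.identityComponent (MulAction.stabilizer G p)) :
    (∀ x ∈ KillingFoliation.regularStratum EG G M, ∃ k : K,
      (KillingFoliation.identityComponent (MulAction.stabilizer G x)).map ι =
        KillingFoliation.conjugate k (L.map ι)) ∧
    (∀ x ∈ KillingFoliation.regularStratum EG G M, ∃ V : Set M,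
      IsOpen V ∧ x ∈ V ∧ V ⊆ KillingFoliation.regularStratum EG G M ∧
      ∃ f : M → K, ContMDiffOn 𝓘(ℝ, EM) 𝓘(ℝ, EK) ∞ f V ∧ ∀ y ∈ V,
        (KillingFoliation.identityComponent (MulAction.stabilizer G y)).map ι =
          KillingFoliation.conjugate (f y) (L.map ι)) := by
  have : IsTopologicalGroup K := topologicalGroup_of_lieGroup 𝓘(ℝ, EK) ∞
  have : ContMDiffSMul 𝓘(ℝ, EG) 𝓘(ℝ, EM) ∞ G M := by
    refine ⟨?_⟩
    have h : ContMDiff (𝓘(ℝ, EG).prod 𝓘(ℝ, EM)) 𝓘(ℝ, EM) ∞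
        ((fun p : G × M ↦ ι p.1) • fun p : G × M ↦ p.2) :=
      ContMDiff.smul (I := 𝓘(ℝ, EK)) (hι_smooth.comp contMDiff_fst) contMDiff_snd
    convert h using 1
    funext q
    exact hres q.1 q.2
  obtain ⟨α, hα, hα1, hα2⟩ :=
    KillingFoliation.exists_conjEquiv (EK := EK) ι hι_smooth hι_inj hι_dense
  have hreg : ∀ x ∈ KillingFoliation.regularStratum EG G M,
      x ∈ KillingFoliation.locRegular EG G := fun x hx ↦
    Filter.mem_of_superset (IsOpen.mem_nhds hx rfl : KillingFoliation.stratum EG G x ∈ 𝓝 x)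
      fun y hy ↦ Eq.symm hy
  have hglob : ∀ x ∈ KillingFoliation.regularStratum EG G M, ∃ k : K,
      (KillingFoliation.identityComponent (MulAction.stabilizer G x)).map ι =
        KillingFoliation.conjugate k (L.map ι) := fun x hx ↦ by
    rw [hL]
    exact KillingFoliation.conjIsotropy_of_locRegular EK EM hres hα hα1 hα2 (hreg x hx)
      (hreg p hp)
  refine ⟨hglob, fun x hx ↦ ?_⟩
  obtain ⟨k, hk⟩ := hglob x hx
  obtain ⟨c, hc, hcx⟩ := KillingFoliation.eventually_map_identityComponent EK EM hres hα hα1 hα2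
    (hreg x hx)
  obtain ⟨V, hV, hVo, hxV⟩ := mem_nhds_iff.1
    ((hc.and hcx).and (IsOpen.mem_nhds hx rfl : KillingFoliation.stratum EG G x ∈ 𝓝 x))
  -- The constant `k` takes `L` to the isotropy component at `x`, and `c y` takes that one to the
  -- component at `y`; hence `f y = c y * k`.
  refine ⟨V, hVo, hxV, fun y hy ↦ ?_, fun y ↦ c y * k, fun y hy ↦ ?_, fun y hy ↦ ?_⟩
  · have h1 : KillingFoliation.subgroupDim EG (MulAction.stabilizer G x) =
        KillingFoliation.subgroupDim EG (MulAction.stabilizer G y) := (hV hy).2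
    have h2 : KillingFoliation.stratum EG G y = KillingFoliation.stratum EG G x := by
      simp only [KillingFoliation.stratum, h1]
    change IsOpen (KillingFoliation.stratum EG G y)
    rw [h2]
    exact hx
  · exact ((hV hy).1.1.mul contMDiffAt_const).contMDiffWithinAt
  · rw [(hV hy).1.2, hk, KillingFoliation.conjugate_conjugate]
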